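/- **Setting.** Let $G$ be a finite-horizon general-sum POSG: a finite set $\mathcal N$ of players, a measurable state space $\mathcal S$ (of any size), finite nonempty action sets $\mathcal A^i$ and finite observation sets $\mathcal O^i$, with products $\mathcal A,\mathcal O$; transition kernels $T(\cdot\mid s,a)$; joint observation probabilities $Z(o\mid s,a,s')$, measurable in $(s,s')$; measurable rewards $r^i(s,a)$ with $|r^i|\le R_{\max,i}$; horizon $D\in\mathbb N$, discount $\gamma\in[0,1]$ and initial law $b_0$. A behavioural policy $\pi^i$ maps the action-observation histories of player $i$ of length at most $D$ to distributions over $\mathcal A^i$, a pure policy $\sigma^i$ maps them to actions, and a mixed strategy is a distribution over pure policies. $\Sigma$ is the finite set of joint pure policies. The utility is $U^i(\pi)=\mathbb E\big[\sum_{t=0}^D\gamma^t r^i(s_t,a_t)\big]$, extended to mixed strategies through the payoff matrices $A^i=(U^i(\sigma))_{\sigma\in\Sigma}$. **Particle CDIT.** Fix $C\ge1$. The root belief has $C$ independent particles from $b_0$ with equal weights. A node at depth less than $D$ with belief $b=\{(s_j,w_j)\}_{j\le C}$ has, for each joint action $a$, $C$ children, drawn independently. For each child one draws $o$ with probability $p(o\mid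 b,a)=\sum_j \bar w_j\int Z(o\mid s_j,a,s')\,T(ds'\mid s_j,a)$, where $\bar w_j=w_j/\sum_k w_k$ ($\bar w_j=1/C$ if all weights vanish), and, independently of $o$ and of each other, $s'_j\sim T(\cdot\mid s_j,a)$; the child's belief is $\{(s'_j,\,w_jZ(o\mid s_j,a,s'_j))\}_j$. The joint history of a node is the sequence of its joint actions and sampled observations. The approximate utility $\hat U^i(\pi)$ is $\hat V$ at the root, where at a node of depth $d$ with joint history $h$ and belief $b$ $$\hat V(h)=\sum_a\pi(a\mid h)\Big[\sum_j\bar w_j r^i(s_j,a)+\frac{\gamma}{C}\sum_{k=1}^C\hat V(h\,a\,o_{a,k})\Big]$$ (without the last term at depth $D$); here $\pi(a\mid h)=\prod_i\pi^i(a^i\mid h^i)$, and $h^i$ is player $i$'s part of $h$. Let $\hat A^i=(\hat U^i(\sigma))_{\sigma\in\Sigma}$, with the same extension to mixed strategies. Fix default pure policies $\sigma^i_{\rm default}$. The surrogate policies of player $i$ are those that follow $\sigma^i_{\rm default}$ at all histories of player $i$ that do not occur in the tree (surrogate mixed strategies are the mixtures of surrogate pure policies). **Deviation incentives.** $\delta_i^{A}(\pi)=\sup_{\pi^{i\prime}}U^i(\pi^{i\prime},\pi^{-i})-U^i(\pi)$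 over all policies $\pi^{i\prime}$ of player $i$, $\mathrm{NashConv}^{A}(\pi)=\sum_i\delta_i^A(\pi)$, and $\delta_{i,s}^{\hat A^i}(\pi)=\sup_{\pi^{i\prime}}\hat U^i(\pi^{i\prime},\pi^{-i})-\hat U^i(\pi)$ over the surrogate policies of player $i$. For a behavioural $\pi$ the deviations are behavioural, for a mixed $\pi$ they are mixed. **Constants.** $V_{\max,i}=R_{\max,i}\sum_{t=0}^D\gamma^t$. $d_\infty^{\max}$ is the maximum of $d_\infty(P\|Q)=\operatorname{ess\,sup}\,dP/dQ$ over all joint histories of length at most $D$ that have positive probability given their actions, where $Q$ is the law of the state trajectory given the actions of the history, and $P$ its law given the actions and the observations. For $\lambda\in\mathbb R$ let $$k_{\max,i}=\frac{\lambda}{4V_{\max,i}\,d_\infty^{\max}}-\frac1{\sqrt C},\qquad \acute k_i=\min\Big\{k_{\max,i},\ \frac{\lambda}{4\sqrt2\,V_{\max,i}}\Big\},\qquad \epsilon_{\omega\pi}=\lambda\Big[2\sum_{t=0}^D\gamma^t-1\Big],$$ where $\sum_{t=0}^D\gamma^t=\frac{1-\gamma^{D+1}}{1-\gamma}$ for $\gamma<1$.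 Assume $R_{\max,i}>0$ and $k_{\max,i}>0$ for all $i$. **Theorem.** With probability at least $$1-5\sum_{i\in\mathcal N}|\Sigma|\,(4C)^{D+1}\exp\!\big(-C\,\acute k_i^{\,2}\big)$$ over the random particle CDIT, the bound $$\mathrm{NashConv}^{A}(\pi)\ \le\ \sum_{i\in\mathcal N}\Big[\delta_{i,s}^{\hat A^i}(\pi)+2\epsilon_{\omega\pi}\Big]$$ holds simultaneously for all joint policies $\pi$, mixed or behavioural (so $\pi$ may depend on the CDIT). -/

import Mathlib

open MeasureTheory ProbabilityTheory
open scoped NNReal ENNReal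

set_option linter.unusedSectionVars false

/-- The set of joint observations, with the discrete sigma-algebra. -/
def JointObs {N : Type*} (O : N → Type*) : Type _ := ∀ i, O i

instance {N : Type*} (O : N → Type*) : MeasurableSpace (JointObs O) := ⊤

noncomputable instance {N : Type*} [Finite N] (O : N → Type*) [∀ i, Finite (O i)] :
    Fintype (JointObs O) :=
  haveI : Finite (JointObs O) := inferInstanceAs (Finite (∀ i, O i))
  Fintype.ofFinite _

/-- The joint law of independent draws, one from each of finitely many Markov kernels, as a
kernel. -/
noncomputable def indepKernel {ι α β : Type*} [Fintype ι] [MeasurableSpace α] [MeasurableSpace β]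
    (κ : ι → Kernel α β) [∀ k, IsMarkovKernel (κ k)] : Kernel α (ι → β) where
  toFun x := Measure.pi fun k => κ k x
  measurable' := by
    refine Measurable.measure_of_isPiSystem_of_isProbabilityMeasure generateFrom_pi.symm
      isPiSystem_pi ?_
    rintro s ⟨t, ht, rfl⟩
    simp only [Measure.pi_pi]
    exact Finset.measurable_prod _ fun k _ =>
      Kernel.measurable_coe _ (ht k (Set.mem_univ k))

instance {ι α β : Type*} [Fintype ι] [MeasurableSpace α] [MeasurableSpace β]
    (κ : ι → Kernel α β) [∀ k, IsMarkovKernel (κ k)] : IsMarkovKernel (indepKernel κ) :=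
  ⟨fun x => inferInstanceAs (IsProbabilityMeasure (Measure.pi fun k => κ k x))⟩

/-- A finite horizon partially observable stochastic game with player set `N`, state space `S`,
action sets `A i` and observation sets `O i`. -/
structure POSG (N : Type*) (S : Type*) [MeasurableSpace S] (A O : N → Type*) [Fintype N]
    [∀ i, Fintype (A i)] [∀ i, Fintype (O i)] where
  /-- State transitions: `T a s` is the law of the next state. -/
  T : (∀ i, A i) → Kernel S S
  T_markov : ∀ a, IsMarkovKernel (T a)
  /-- `Z a s s' o` is the probability of the joint observation `o` given a transition from `s` to
  `s'` via the joint action `a`. (Separate observation functions for the players are the case in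
  which this is a product over the players.) -/
  Z : (∀ i, A i) → S → S → JointObs O → ℝ≥0
  Z_measurable : ∀ a o, Measurable fun p : S × S => Z a p.1 p.2 o
  Z_sum : ∀ a s s', ∑ o, Z a s s' o = 1
  /-- Rewards. -/
  r : N → S → (∀ i, A i) → ℝ
  r_measurable : ∀ i a, Measurable fun s => r i s a
  /-- The horizon: the time steps are `0, …, D`. -/
  D : ℕ
  /-- The discount factor. -/
  γ : ℝ
  γ_nonneg : 0 ≤ γ
  γ_le_one : γ ≤ 1
  /-- The initial state distribution. -/
  b₀ : Measure S
  b₀_prob : IsProbabilityMeasure b₀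

universe uN uS uA uO

namespace POSG

attribute [instance] POSG.T_markov POSG.b₀_prob

variable {N : Type uN} [Fintype N] [DecidableEq N] {S : Type uS} [MeasurableSpace S]
  {A : N → Type uA} {O : N → Type uO}
  [∀ i, Fintype (A i)] [∀ i, Fintype (O i)] (G : POSG N S A O)

/-! ### Histories and policies

Histories are lists of action-observation pairs, the most recent pair first. -/

/-- Joint action-observation histories. -/
abbrev JointHist (_ : POSG N S A O) : Type _ := List ((∀ i, A i) × JointObs O)

/-- The part of a joint history that player `i` sees: the own actions and observations. -/
def proj (i : N) (l : G.JointHist) : List (A i × O i) := l.map fun x => (x.1 i, x.2 i)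

/-- Action-observation histories of player `i` at the decision times `0, …, D`. -/
abbrev Hist (i : N) : Type _ := {l : List (A i × O i) // l.length ≤ G.D}

/-- The information of player `i` at the joint history `l`, when `n` steps remain. -/
def info (i : N) (l : G.JointHist) {n : ℕ} (hl : l.length + n = G.D) : G.Hist i :=
  ⟨G.proj i l, by simp only [proj, List.length_map]; omega⟩

/-- Pure policies of player `i`. -/
abbrev Pure (i : N) : Type _ := G.Hist i → A i

/-- Behavioural policies of player `i`: from histories to distributions over actions. -/
abbrev Behav (i : N) : Type _ := G.Hist i → stdSimplex ℝ (A i)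

instance (i : N) : Finite (G.Hist i) := Set.Finite.to_subtype (List.finite_length_le _ _)

noncomputable instance (i : N) : Fintype (G.Pure i) := Fintype.ofFinite _

/-- Mixed strategies of player `i`: distributions over pure policies. -/
abbrev Mixed (i : N) : Type _ := stdSimplex ℝ (G.Pure i)

open Classical in
/-- The point mass at `a`. -/
noncomputable def pointMass {X : Type*} [Fintype X] (a : X) : stdSimplex ℝ X :=
  ⟨Pi.single a 1, single_mem_stdSimplex ℝ a⟩

/-- A pure policy as a behavioural policy. -/
noncomputable def Pure.toBehav {G : POSG N S A O} {i : N} (σ : G.Pure i) : G.Behav i :=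
  fun h => pointMass (σ h)

/-- The number `|Σ|` of joint pure policies. -/
noncomputable def numPure : ℕ := Fintype.card (∀ i, G.Pure i)

/-- The probability of the joint action `a` at the joint history `l` under `π`. -/
noncomputable def actProb (π : ∀ i, G.Behav i) (l : G.JointHist) {n : ℕ}
    (hl : l.length + n = G.D) (a : ∀ i, A i) : ℝ :=
  ∏ i, (π i (G.info i l hl)).1 (a i)

/-! ### Utilities in the true game -/

/-- The expected discounted reward of player `i` under `π` from the state `s` and the joint
history `l` on, over the present step and the `n` steps that follow. -/
noncomputable def value (π : ∀ i, G.Behav i) (i : N) :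
    (n : ℕ) → (l : G.JointHist) → l.length + n = G.D → S → ℝ
  | 0, l, hl, s => ∑ a, G.actProb π l hl a * G.r i s a
  | n + 1, l, hl, s => ∑ a, G.actProb π l hl a *
      (G.r i s a + G.γ * ∫ s', ∑ o, (G.Z a s s' o : ℝ) *
        value π i n ((a, o) :: l) (by rw [List.length_cons]; omega) s' ∂(G.T a s))

/-- The utility `U^i(π)`. -/
noncomputable def utility (i : N) (π : ∀ i, G.Behav i) : ℝ :=
  ∫ s, G.value π i G.D [] (by simp) s ∂G.b₀

/-! ### The particle tree built by sparse sampling -/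

/-- A belief with `C` weighted particles. -/
abbrev Belief (_ : POSG N S A O) (C : ℕ) : Type _ := Fin C → S × ℝ≥0

/-- The normalized weight of a particle (uniform if all weights vanish). -/
noncomputable def normWeight {C : ℕ} (b : G.Belief C) (j : Fin C) : ℝ≥0 :=
  if ∑ k, (b k).2 = 0 then (C : ℝ≥0)⁻¹ else (b j).2 / ∑ k, (b k).2

/-- The particle estimate of the reward of player `i`. -/
noncomputable def rewardEst {C : ℕ} (i : N) (b : G.Belief C) (a : ∀ i, A i) : ℝ :=
  ∑ j, (G.normWeight b j : ℝ) * G.r i (b j).1 a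

/-- The probability of the joint observation `o` after the joint action `a` in the belief `b`. -/
noncomputable def obsProb {C : ℕ} (b : G.Belief C) (a : ∀ i, A i) (o : JointObs O) : ℝ≥0∞ :=
  ∑ j, (G.normWeight b j : ℝ≥0∞) * ∫⁻ s', (G.Z a (b j).1 s' o : ℝ≥0∞) ∂(G.T a (b j).1)

lemma measurable_normWeight {C : ℕ} (j : Fin C) :
    Measurable fun b : G.Belief C => G.normWeight b j := by
  unfold normWeight
  have h : Measurable fun b : G.Belief C => ∑ k, (b k).2 := by fun_prop
  exact Measurable.ite (measurableSet_eq_fun h measurable_const) measurable_const (by fun_prop)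

lemma sum_normWeight {C : ℕ} (hC : 0 < C) (b : G.Belief C) : ∑ j, G.normWeight b j = 1 := by
  unfold normWeight
  split_ifs with h
  · have : (C : ℝ≥0) ≠ 0 := by exact_mod_cast hC.ne'
    simp [this]
  · rw [← Finset.sum_div, div_self h]

lemma measurable_obsProb {C : ℕ} (a : ∀ i, A i) (o : JointObs O) :
    Measurable fun b : G.Belief C => G.obsProb b a o := by
  unfold obsProb
  refine Finset.measurable_sum _ fun j _ => Measurable.mul ?_ ?_
  · exact (G.measurable_normWeight j).coe_nnreal_ennreal
  · have h : Measurable fun s => ∫⁻ s', (G.Z a s s' o : ℝ≥0∞) ∂(G.T a s) :=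
      Measurable.lintegral_kernel_prod_right' (κ := G.T a)
        (f := fun p : S × S => (G.Z a p.1 p.2 o : ℝ≥0∞))
        (G.Z_measurable a o).coe_nnreal_ennreal
    exact h.comp (by fun_prop : Measurable fun b : G.Belief C => (b j).1)

lemma sum_obsProb {C : ℕ} (hC : 0 < C) (b : G.Belief C) (a : ∀ i, A i) :
    ∑ o, G.obsProb b a o = 1 := by
  unfold obsProb
  rw [Finset.sum_comm]
  have h : ∀ s, ∑ o, ∫⁻ s', (G.Z a s s' o : ℝ≥0∞) ∂(G.T a s) = 1 := by
    intro s
    have hZ : ∀ o, Measurable fun s' => (G.Z a s s' o : ℝ≥0∞) := fun o =>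
      ((G.Z_measurable a o).comp measurable_prodMk_left).coe_nnreal_ennreal
    rw [← lintegral_finsetSum _ fun o _ => hZ o]
    have : ∀ s', ∑ o, (G.Z a s s' o : ℝ≥0∞) = 1 := fun s' => by
      rw [← ENNReal.ofNNReal_finsetSum, G.Z_sum, ENNReal.coe_one]
    simp [this]
  simp_rw [← Finset.mul_sum, h, mul_one]
  rw [← ENNReal.ofNNReal_finsetSum, G.sum_normWeight hC, ENNReal.coe_one]

/-- The law of the sampled joint observation. -/
noncomputable def obsKernel (C : ℕ) (a : ∀ i, A i) : Kernel (G.Belief C) (JointObs O) where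
  toFun b := ∑ o, G.obsProb b a o • Measure.dirac o
  measurable' := by
    refine Measure.measurable_of_measurable_coe _ fun s _ => ?_
    simp only [Measure.coe_finsetSum, Finset.sum_apply, Measure.smul_apply, smul_eq_mul]
    exact Finset.measurable_sum _ fun o _ => (G.measurable_obsProb a o).mul_const _

instance (C : ℕ) [NeZero C] (a : ∀ i, A i) : IsMarkovKernel (G.obsKernel C a) :=
  ⟨fun b => ⟨by
    change (∑ o, G.obsProb b a o • Measure.dirac o : Measure (JointObs O)) Set.univ = 1
    simpa using G.sum_obsProb (NeZero.pos C) b a⟩⟩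

/-- The law of the propagated particle states: `s'_j ∼ T(· | s_j, a)`, independently. -/
noncomputable def moveKernel (C : ℕ) (a : ∀ i, A i) : Kernel (G.Belief C) (Fin C → S) :=
  indepKernel fun j => (G.T a).comap (fun b : G.Belief C => (b j).1) (by fun_prop)

instance (C : ℕ) (a : ∀ i, A i) : IsMarkovKernel (G.moveKernel C a) := by
  unfold moveKernel; infer_instance

/-- The belief with the propagated states `s'` and the weights `w_j * Z(o | s_j, a, s'_j)`. -/
noncomputable def update {C : ℕ} (a : ∀ i, A i) (b : G.Belief C) (o : JointObs O)
    (s' : Fin C → S) : G.Belief C :=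
  fun j => (s' j, (b j).2 * G.Z a (b j).1 (s' j) o)

lemma measurable_update {C : ℕ} (a : ∀ i, A i) :
    Measurable fun p : G.Belief C × (JointObs O × (Fin C → S)) =>
      (p.2.1, G.update a p.1 p.2.1 p.2.2) := by
  have : MeasurableSingletonClass (JointObs O) := ⟨fun _ => trivial⟩
  refine Measurable.prodMk (by fun_prop) (measurable_pi_lambda _ fun j => ?_)
  refine Measurable.prodMk (by fun_prop) (Measurable.mul (by fun_prop) ?_)
  have h : Measurable fun q : JointObs O × (S × S) => G.Z a q.2.1 q.2.2 q.1 :=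
    measurable_from_prod_countable_right fun o => G.Z_measurable a o
  exact h.comp (by fun_prop : Measurable fun p : G.Belief C × (JointObs O × (Fin C → S)) =>
    (p.2.1, ((p.1 j).1, p.2.2 j)))

/-- The law of one child of a node with belief `b` under the joint action `a`: a sampled joint
observation and the updated particle belief. -/
noncomputable def childKernel (C : ℕ) (a : ∀ i, A i) :
    Kernel (G.Belief C) (JointObs O × G.Belief C) :=
  (Kernel.id ×ₖ (G.obsKernel C a ×ₖ G.moveKernel C a)).map
    fun p => (p.2.1, G.update a p.1 p.2.1 p.2.2)

instance (C : ℕ) [NeZero C] (a : ∀ i, A i) : IsMarkovKernel (G.childKernel C a) := by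
  unfold childKernel; exact Kernel.IsMarkovKernel.map _ (G.measurable_update a)

/-- The part below a node of a particle tree of depth `n`: for every joint action `C` children,
each with its joint observation, its belief and what is below it. -/
def Tree (G : POSG N S A O) (C : ℕ) : ℕ → Type (max uN uS uA uO)
  | 0 => PUnit
  | n + 1 => (∀ i, A i) × Fin C → (JointObs O × G.Belief C) × Tree G C n

instance Tree.measurableSpace (C : ℕ) : (n : ℕ) → MeasurableSpace (G.Tree C n)
  | 0 => inferInstanceAs (MeasurableSpace PUnit)
  | n + 1 =>
    letI := Tree.measurableSpace C n
    inferInstanceAs (MeasurableSpace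
      ((∀ i, A i) × Fin C → (JointObs O × G.Belief C) × G.Tree C n))

/-- The law of all children of a node with what is below them, as a function of the belief at the
node. The children are independent, and `κ` gives the law of what is below a child as a function of
the belief at the child. -/
noncomputable def treeStep (C : ℕ) [NeZero C] {X : Type*} [MeasurableSpace X]
    (κ : Kernel (G.Belief C) X) [IsMarkovKernel κ] :
    Kernel (G.Belief C) ((∀ i, A i) × Fin C → (JointObs O × G.Belief C) × X) :=
  indepKernel fun x => G.childKernel C x.1 ⊗ₖ
    κ.comap (fun p : G.Belief C × (JointObs O × G.Belief C) => p.2.2) (by fun_prop)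

instance (C : ℕ) [NeZero C] {X : Type*} [MeasurableSpace X] (κ : Kernel (G.Belief C) X)
    [IsMarkovKernel κ] : IsMarkovKernel (G.treeStep C κ) := by
  unfold treeStep; infer_instance

/-- The law of the tree below a node as a function of the belief at the node. -/
noncomputable def treeLaw (C : ℕ) [NeZero C] :
    (n : ℕ) → {κ : Kernel (G.Belief C) (G.Tree C n) // IsMarkovKernel κ}
  | 0 => ⟨Kernel.const _ (Measure.dirac PUnit.unit),
      inferInstanceAs (IsMarkovKernel (Kernel.const (G.Belief C) (Measure.dirac PUnit.unit)))⟩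
  | n + 1 =>
    have := (treeLaw C n).2
    ⟨G.treeStep C (treeLaw C n).1,
      (inferInstance : IsMarkovKernel (G.treeStep C (treeLaw C n).1))⟩

/-- A particle CDIT of depth `D`: the belief at the root and the tree below it. -/
abbrev CDIT (C : ℕ) : Type _ := G.Belief C × G.Tree C G.D

/-- The law of the particle CDIT: the `C` particles at the root are independent draws from `b₀`
with equal weights. -/
noncomputable def cditLaw (C : ℕ) [NeZero C] : Measure (G.CDIT C) :=
  ((Measure.pi fun _ : Fin C => G.b₀).map fun s j => (s j, 1)) ⊗ₘ (G.treeLaw C G.D).1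

instance (C : ℕ) [NeZero C] : IsProbabilityMeasure (G.cditLaw C) := by
  have := (G.treeLaw C G.D).2
  have : IsProbabilityMeasure ((Measure.pi fun _ : Fin C => G.b₀).map
      fun s j => ((s j, 1) : S × ℝ≥0)) :=
    Measure.isProbabilityMeasure_map (by fun_prop : Measurable _).aemeasurable
  unfold cditLaw; infer_instance

/-! ### Utilities in the approximate game -/

/-- The estimate on the tree of the expected discounted reward of player `i` under `π` from a node
on. -/
noncomputable def valueEst {C : ℕ} (π : ∀ i, G.Behav i) (i : N) :
    (n : ℕ) → (l : G.JointHist) → l.length + n = G.D → G.Belief C → G.Tree C n → ℝ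
  | 0, l, hl, b, _ => ∑ a, G.actProb π l hl a * G.rewardEst i b a
  | n + 1, l, hl, b, τ => ∑ a, G.actProb π l hl a *
      (G.rewardEst i b a + G.γ / C * ∑ k, valueEst π i n ((a, (τ (a, k)).1.1) :: l)
        (by rw [List.length_cons]; omega) (τ (a, k)).1.2 (τ (a, k)).2)

/-- The approximate utility `Û^i(π)`. -/
noncomputable def utilityEst {C : ℕ} (τ : G.CDIT C) (i : N) (π : ∀ i, G.Behav i) : ℝ :=
  G.valueEst π i G.D [] (by simp) τ.1 τ.2

/-- The joint histories of the nodes of a tree whose root has history `l`. -/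
def sampledHist {C : ℕ} : (n : ℕ) → G.JointHist → G.Tree C n → Set G.JointHist
  | 0, l, _ => {l}
  | n + 1, l, τ => {l} ∪ ⋃ x, sampledHist n ((x.1, (τ x).1.1) :: l) (τ x).2

/-- The histories of player `i` that occur in the tree. -/
def sampledInfo {C : ℕ} (τ : G.CDIT C) (i : N) : Set (G.Hist i) :=
  {h | ∃ l ∈ G.sampledHist G.D [] τ.2, G.proj i l = h.1}

/-- The surrogate pure policies of player `i`: arbitrary on the histories in the tree, equal to the
default policy elsewhere. -/
def surrogatePure {C : ℕ} (τ : G.CDIT C) {i : N} (σ₀ : G.Pure i) : Set (G.Pure i) :=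
  {σ | ∀ h ∉ G.sampledInfo τ i, σ h = σ₀ h}

/-- The mixtures of surrogate pure policies. -/
def surrogateMixed {C : ℕ} (τ : G.CDIT C) {i : N} (σ₀ : G.Pure i) : Set (G.Mixed i) :=
  {x | ∀ σ ∉ G.surrogatePure τ σ₀, x.1 σ = 0}

/-- The behavioural surrogate policies. -/
def surrogateBehav {C : ℕ} (τ : G.CDIT C) {i : N} (σ₀ : G.Pure i) : Set (G.Behav i) :=
  {π | ∀ h ∉ G.sampledInfo τ i, π h = pointMass (σ₀ h)}

/-! ### Deviation incentives -/

/-- The entries of the payoff matrix of player `i`, for a utility function `u`. -/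
noncomputable def payoff (u : N → (∀ i, G.Behav i) → ℝ) (i : N) (σ : ∀ i, G.Pure i) : ℝ :=
  u i fun j => (σ j).toBehav

/-- The expectation of a payoff matrix under mixed strategies. -/
noncomputable def mixedPayoff (M : (∀ i, G.Pure i) → ℝ) (x : ∀ i, G.Mixed i) : ℝ :=
  ∑ σ, (∏ j, (x j).1 (σ j)) * M σ

/-- The deviation incentive `sup_{p ∈ K} u(p, π^{-i}) - u(π)` of player `i` at the profile `π`, for
deviations in the set `K`. -/
noncomputable def devIncentive {P : N → Type*} (u : (∀ i, P i) → ℝ) (i : N) (K : Set (P i))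
    (π : ∀ i, P i) : ℝ :=
  sSup ((fun p => u (Function.update π i p)) '' K) - u π

/-- `NashConv`: the sum of the deviation incentives of all players. -/
noncomputable def nashConv {P : N → Type*} (u : N → (∀ i, P i) → ℝ) (π : ∀ i, P i) : ℝ :=
  ∑ i, devIncentive (u i) i Set.univ π

/-! ### The constants -/

/-- The law of a single weighted particle `(s_d, w_d)` that is propagated along the actions of the
history `l` and weighted by its observations, started at `b₀` with weight one. Here `w_d` is the
likelihood of the observations given the simulated states, and the mean of `w_d` is the probability
of the observations given the actions. -/
noncomputable def weightLaw : G.JointHist → Measure (S × ℝ≥0)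
  | [] => G.b₀.map fun s => (s, 1)
  | (a, o) :: l => (weightLaw l ⊗ₘ (G.T a).comap (Prod.fst : S × ℝ≥0 → S) measurable_fst).map
      fun p => (p.2, p.1.2 * G.Z a p.1.1 p.2 o)

/-- The infinite-order Rényi divergence (without logarithm) `ess sup dP/dQ` of the law `P` of the
state trajectory given the joint history `l` from its law `Q` given only the actions of `l`. The
density `dP/dQ` is the likelihood of the observations divided by its mean. (It is zero for a
history of probability zero.) -/
noncomputable def dInf (l : G.JointHist) : ℝ≥0∞ :=
  essSup (fun x => (x.2 : ℝ≥0∞)) (G.weightLaw l) / ∫⁻ x, (x.2 : ℝ≥0∞) ∂(G.weightLaw l)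

/-- The largest of these divergences over the histories up to depth `D`. It is finite, as there are
finitely many histories and each likelihood is at most one. -/
noncomputable def dInfMax : ℝ := (⨆ l : {l : G.JointHist // l.length ≤ G.D}, G.dInf l.1).toReal

/-- The sum `1 + γ + ⋯ + γ ^ D`. -/
noncomputable def geom : ℝ := ∑ t ∈ Finset.range (G.D + 1), G.γ ^ t

/-- The bound on values that belongs to the bound `R` on rewards. -/
noncomputable def vMax (R : ℝ) : ℝ := R * G.geom

/-- The constant `k_max`. -/
noncomputable def kMax (lam : ℝ) (C : ℕ) (R : ℝ) : ℝ :=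
  lam / (4 * G.vMax R * G.dInfMax) - 1 / √(C : ℝ)

/-- The constant `ḱ`. -/
noncomputable def kAcute (lam : ℝ) (C : ℕ) (R : ℝ) : ℝ :=
  min (G.kMax lam C R) (lam / (4 * √2 * G.vMax R))

/-- The error `ε_ωπ`. -/
noncomputable def eps (lam : ℝ) : ℝ := lam * (2 * G.geom - 1)

end POSG

/-! It suffices that `Û^i(σ)` is within `eps` of `U^i(σ)` for all players and all pure profiles.
Mixed payoffs are convex combinations of pure ones, and utilities and their estimates are affine in
the behaviour at each single history (`IsMultiaffine`), so the same error bound holds for all mixed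
and behavioural profiles at once. The estimate reads policies only at histories in the tree
(`valueEst_congr`), so restricting deviations to surrogates does not lower the best estimated
deviation. Comparing the two utilities at the deviation and at the profile costs `2 * eps` per
player (`devIncentive_univ_le`).

For one pure profile the difficulty is that observations are drawn from the particles themselves:
given its history, the belief at a node is not a family of independent particles. The induction
`lintegral_failProb_le` therefore bounds the failure probability of the subtree estimate averaged
over an auxiliary law, `beliefLaw`, of independent weighted particles along a fixed history. At the
root this is the true law.

Let `p` be the likelihood of the history. Under `beliefLaw` each weight is at most `dInfMax * p`, so
Hoeffding's inequality shows that, outside an event of probability `3 * exp (-C K)`, the total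
weight exceeds `C p / 2` and the self-normalized estimate of `lookahead` is within `lam` of the
history value (`beliefLaw_not_good_le`). The average over the sampled children adds an error `γ *
lam` with failure probability `2 * exp (-C K)`, and the children's own errors add the rest
(`failProb_succ_le`).

The passage to the children is a change of measure. At a good belief the probability of `o` is at
most `2 / p` times an average of independent terms with mean `p_o`, the likelihood of the extended
history. This average is at most `2 * p_o` up to an excess with exponentially small mean
(`lintegral_obs_mul_le`), and for fixed `o` the updated particles are again independent
(`lintegral_moveKernel_update`). As the `p_o` add up to `p`, the likelihoods cancel, and each level
multiplies the bound by about `4 C`. The union bound over players and pure profiles finishes the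
proof. -/

section Concentration

/-! ### Hoeffding bounds for sums of independent copies -/

variable {ι κ β : Type*} [Fintype ι] [Fintype κ] [MeasurableSpace β] {μ : ι → Measure β}
  [∀ i, IsProbabilityMeasure (μ i)] {e : κ → ι} {ν : Measure β} [IsProbabilityMeasure ν]
  {g : β → ℝ} {lo B : ℝ}

/-- Hoeffding's lemma applies to each centred coordinate, and variance proxies add under
independence. The injection `e` selects coordinates because the children of a node are indexed by
action and number, and only those of one action are averaged. -/
theorem hasSubgaussianMGF_sum_pi (he : Function.Injective e) (hν : ∀ k, μ (e k) = ν)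
    (hg : Measurable g) (hB : 0 ≤ B) (hb : ∀ᵐ x ∂ν, g x ∈ Set.Icc lo (lo + B)) :
    HasSubgaussianMGF (fun ω => ∑ k, (g (ω (e k)) - ∫ x, g x ∂ν))
      (∑ _k : κ, (B.toNNReal / 2) ^ 2) (Measure.pi μ) := by
  have h1 := iIndepFun_pi (μ := μ) (X := fun _ x => g x - ∫ x, g x ∂ν)
    fun i => (hg.sub_const _).aemeasurable
  refine HasSubgaussianMGF.sum_of_iIndepFun (h1.precomp he) fun k _ => ?_
  refine HasSubgaussianMGF.of_map (Y := fun ω : ι → β => ω (e k))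
    (X := fun x => g x - ∫ x, g x ∂ν) (measurable_pi_apply (e k)).aemeasurable ?_
  rw [(measurePreserving_eval μ (e k)).map_eq, hν k]
  have := hasSubgaussianMGF_of_mem_Icc hg.aemeasurable hb
  have hBB : ‖lo + B - lo‖₊ = B.toNNReal := by
    rw [add_sub_cancel_left, ← Real.toNNReal_eq_nnnorm_of_nonneg hB]
  rwa [hBB] at this

/-- One-sided Hoeffding inequality for averages of independent copies. -/
theorem measure_pi_sum_ge_le (he : Function.Injective e) (hν : ∀ k, μ (e k) = ν)
    (hg : Measurable g) (hB : 0 ≤ B) (hb : ∀ᵐ x ∂ν, g x ∈ Set.Icc lo (lo + B))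
    {η : ℝ} (hη : 0 ≤ η) :
    Measure.pi μ {ω | Fintype.card κ * η ≤ ∑ k, (g (ω (e k)) - ∫ x, g x ∂ν)} ≤
      ENNReal.ofReal (Real.exp (-(2 * Fintype.card κ * η ^ 2 / B ^ 2))) := by
  have h := (hasSubgaussianMGF_sum_pi he hν hg hB hb).measure_ge_le
    (ε := Fintype.card κ * η) (by positivity)
  rw [← ofReal_measureReal]
  refine ENNReal.ofReal_le_ofReal (h.trans_eq ?_)
  congr 1
  simp only [Finset.sum_const, Finset.card_univ, nsmul_eq_mul, NNReal.coe_mul, NNReal.coe_natCast,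
    NNReal.coe_pow, NNReal.coe_div, NNReal.coe_ofNat, Real.coe_toNNReal _ hB]
  -- In the degenerate cases both exponents are zero, partly by the convention for division by zero.
  rcases eq_or_ne B 0 with rfl | hB0
  · simp
  rcases eq_or_ne (Fintype.card κ : ℝ) 0 with h0 | h0
  · simp [h0]
  field_simp

theorem measure_pi_sum_le_le (he : Function.Injective e) (hν : ∀ k, μ (e k) = ν)
    (hg : Measurable g) (hB : 0 ≤ B) (hb : ∀ᵐ x ∂ν, g x ∈ Set.Icc lo (lo + B))
    {η : ℝ} (hη : 0 ≤ η) :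
    Measure.pi μ {ω | ∑ k, (g (ω (e k)) - ∫ x, g x ∂ν) ≤ -(Fintype.card κ * η)} ≤
      ENNReal.ofReal (Real.exp (-(2 * Fintype.card κ * η ^ 2 / B ^ 2))) := by
  have hb' : ∀ᵐ x ∂ν, (-g) x ∈ Set.Icc (-(lo + B)) (-(lo + B) + B) := by
    filter_upwards [hb] with x hx
    constructor <;> simp only [Pi.neg_apply] <;> linarith [hx.1, hx.2]
  have h := measure_pi_sum_ge_le he hν hg.neg hB hb' hη
  refine (measure_mono fun ω hω => ?_).trans h
  simp only [Pi.neg_apply, integral_neg, Set.mem_ofPred_eq] at hω ⊢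
  have : ∑ k, (-g (ω (e k)) - -∫ x, g x ∂ν) = -∑ k, (g (ω (e k)) - ∫ x, g x ∂ν) := by
    rw [← Finset.sum_neg_distrib]; exact Finset.sum_congr rfl fun _ _ => by ring
  rw [this]; linarith

/-- Two-sided Hoeffding inequality for averages of independent copies. -/
theorem measure_pi_abs_sum_ge_le (he : Function.Injective e) (hν : ∀ k, μ (e k) = ν)
    (hg : Measurable g) (hB : 0 ≤ B) (hb : ∀ᵐ x ∂ν, g x ∈ Set.Icc lo (lo + B))
    {η : ℝ} (hη : 0 ≤ η) :
    Measure.pi μ {ω | Fintype.card κ * η ≤ |∑ k, (g (ω (e k)) - ∫ x, g x ∂ν)|} ≤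
      2 * ENNReal.ofReal (Real.exp (-(2 * Fintype.card κ * η ^ 2 / B ^ 2))) := by
  have h1 := measure_pi_sum_ge_le he hν hg hB hb hη
  have h2 := measure_pi_sum_le_le he hν hg hB hb hη
  rw [two_mul]
  refine le_trans (measure_mono ?_) ((measure_union_le _ _).trans (add_le_add h1 h2))
  intro ω hω
  rcases le_abs.1 (Set.mem_ofPred_eq ▸ hω) with h | h
  · exact Or.inl h
  · refine Or.inr ?_
    simp only [Set.mem_ofPred_eq]
    linarith

/-- The mean excess of an average of independent copies over twice its mean. -/
theorem lintegral_pi_excess_le [Nonempty κ] (he : Function.Injective e) (hν : ∀ k, μ (e k) = ν)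
    (hg : Measurable g) (hb : ∀ᵐ x ∂ν, g x ∈ Set.Icc 0 B) (hm : 0 < ∫ x, g x ∂ν)
    (hBm : B ^ 2 ≤ 4 * Fintype.card κ * (∫ x, g x ∂ν) ^ 2) :
    ∫⁻ ω, ENNReal.ofReal ((∑ k, g (ω (e k))) / Fintype.card κ - 2 * ∫ x, g x ∂ν) ∂Measure.pi μ ≤
      ENNReal.ofReal ((∫ x, g x ∂ν) *
        Real.exp (-(2 * Fintype.card κ * (∫ x, g x ∂ν) ^ 2 / B ^ 2))) := by
  set m := ∫ x, g x ∂ν with hmdef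
  have hB : 0 < B := by
    by_contra hB
    have : ∫ x, g x ∂ν ≤ ∫ x, (0 : ℝ) ∂ν := by
      refine integral_mono_of_nonneg ?_ (integrable_const _) ?_
      · filter_upwards [hb] with x hx using hx.1
      · filter_upwards [hb] with x hx using hx.2.trans (not_lt.1 hB)
    simp only [integral_zero] at this
    linarith
  have hC : (0 : ℝ) < Fintype.card κ := by exact_mod_cast Fintype.card_pos
  set C : ℝ := (Fintype.card κ : ℝ) with hCdef
  have hs := hasSubgaussianMGF_sum_pi (lo := 0) he hν hg hB.le (by simpa using hb)
  -- The minimizer of the Chernoff exponent for an average that exceeds its mean by `m`.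
  set t : ℝ := 4 * m / B ^ 2 with ht
  -- With `θ = C * m * t` this is `u ≤ exp (θ * u)`, valid for `θ ≥ 1`; the hypothesis `hBm` says
  -- exactly that `θ ≥ 1`.
  have hpt : ∀ ω : ι → β, (∑ k, g (ω (e k))) / C - 2 * m ≤
      m * Real.exp (-(C * m * t)) * Real.exp (t * ∑ k, (g (ω (e k)) - m)) := by
    intro ω
    have hsum : ∑ k, (g (ω (e k)) - m) = (∑ k, g (ω (e k))) - C * m := by
      rw [Finset.sum_sub_distrib]; simp [hCdef]
    rw [hsum, mul_assoc, ← Real.exp_add]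
    set y := ∑ k, g (ω (e k))
    set u := y / (C * m) - 2 with hu
    have hy : y / C - 2 * m = m * u := by rw [hu]; field_simp
    rw [hy]
    refine mul_le_mul_of_nonneg_left ?_ hm.le
    have hexp : -(C * m * t) + t * (y - C * m) = (C * m * t) * u := by
      rw [hu]; field_simp; ring
    rw [hexp]
    have hθ : 1 ≤ C * m * t := by
      rw [ht, ← mul_div_assoc, le_div_iff₀ (by positivity)]; nlinarith
    rcases le_or_gt u 0 with h | h
    · exact h.trans (Real.exp_pos _).le
    · have := Real.add_one_le_exp (C * m * t * u)
      nlinarith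
  have hint := hs.integrable_exp_mul t
  calc _ ≤ ∫⁻ ω, ENNReal.ofReal (m * Real.exp (-(C * m * t)) *
          Real.exp (t * ∑ k, (g (ω (e k)) - m))) ∂Measure.pi μ :=
        lintegral_mono fun ω => ENNReal.ofReal_le_ofReal (hpt ω)
    _ = ENNReal.ofReal (m * Real.exp (-(C * m * t)) *
          mgf (fun ω => ∑ k, (g (ω (e k)) - m)) (Measure.pi μ) t) := by
        rw [← ofReal_integral_eq_lintegral_ofReal (hint.const_mul _)
          (Filter.Eventually.of_forall fun ω => by positivity), integral_const_mul, mgf]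
    _ ≤ _ := by
        refine ENNReal.ofReal_le_ofReal ?_
        rw [mul_assoc]
        refine mul_le_mul_of_nonneg_left ?_ hm.le
        refine (mul_le_mul_of_nonneg_left (hs.mgf_le t) (Real.exp_pos _).le).trans_eq ?_
        rw [← Real.exp_add]
        congr 1
        simp only [Finset.sum_const, Finset.card_univ, nsmul_eq_mul, NNReal.coe_mul,
          NNReal.coe_natCast, NNReal.coe_pow, NNReal.coe_div, NNReal.coe_ofNat,
          Real.coe_toNNReal _ hB.le, ← hCdef, ht]
        field_simp
        ring

end Concentration

/-- Independent draws from `ν ⊗ κ`, coordinate by coordinate. -/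
theorem pi_compProd_map {ι α β δ : Type*} [Fintype ι] [MeasurableSpace α] [MeasurableSpace β]
    [MeasurableSpace δ] (ν : Measure α) [IsProbabilityMeasure ν] (κ : Kernel α β)
    [IsMarkovKernel κ] {f : α × β → δ} (hf : Measurable f) :
    (Measure.pi (fun _ : ι => ν) ⊗ₘ
        indepKernel fun j : ι => κ.comap (fun b : ι → α => b j) (by fun_prop)).map
      (fun p j => f (p.1 j, p.2 j)) = Measure.pi fun _ : ι => (ν ⊗ₘ κ).map f := by
  have : IsProbabilityMeasure ((ν ⊗ₘ κ).map f) :=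
    Measure.isProbabilityMeasure_map hf.aemeasurable
  symm
  refine Measure.pi_eq fun s hs => ?_
  have hF : Measurable fun p : (ι → α) × (ι → β) => fun j => f (p.1 j, p.2 j) :=
    measurable_pi_lambda _ fun j => hf.comp (by fun_prop)
  rw [Measure.map_apply hF (MeasurableSet.univ_pi hs),
    Measure.compProd_apply (hF (MeasurableSet.univ_pi hs))]
  have h1 : ∀ b : ι → α, indepKernel (fun j : ι => κ.comap (fun b : ι → α => b j) (by fun_prop)) b
      (Prod.mk b ⁻¹' ((fun (p : (ι → α) × (ι → β)) j => f (p.1 j, p.2 j)) ⁻¹' Set.univ.pi s)) =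
      ∏ j, κ (b j) {y | f (b j, y) ∈ s j} := by
    intro b
    have : (Prod.mk b ⁻¹' ((fun (p : (ι → α) × (ι → β)) j => f (p.1 j, p.2 j)) ⁻¹'
        Set.univ.pi s)) = Set.univ.pi fun j => {y | f (b j, y) ∈ s j} := by
      ext y; simp [Set.mem_pi]
    rw [this]
    change Measure.pi (fun j => κ.comap (fun b : ι → α => b j) (by fun_prop) b) _ = _
    rw [Measure.pi_pi]
    rfl
  simp_rw [h1]
  have hm : ∀ j, Measurable fun a => κ a {y | f (a, y) ∈ s j} := fun j =>
    Kernel.measurable_kernel_prodMk_left (κ := κ) (hf (hs j))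
  have h2 := lintegral_prod_eq_prod_lintegral_of_indepFun (μ := Measure.pi fun _ : ι => ν)
    Finset.univ (fun j (b : ι → α) => κ (b j) {y | f (b j, y) ∈ s j})
    (iIndepFun_pi (X := fun j a => κ a {y | f (a, y) ∈ s j}) fun j => (hm j).aemeasurable)
    (fun j => (hm j).comp (measurable_pi_apply j))
  rw [h2]
  refine Finset.prod_congr rfl fun j _ => ?_
  rw [Measure.map_apply hf (hs j), Measure.compProd_apply (hf (hs j)),
    (measurePreserving_eval (fun _ : ι => ν) j).lintegral_comp (hm j)]
  rfl

namespace POSG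

variable {N : Type uN} [Fintype N] [DecidableEq N] {S : Type uS} [MeasurableSpace S]
  {A : N → Type uA} {O : N → Type uO}
  [∀ i, Fintype (A i)] [∀ i, Fintype (O i)] (G : POSG N S A O)

/-! ### Values: measurability and bounds -/

instance : MeasurableSingletonClass (JointObs O) := ⟨fun _ => trivial⟩

theorem actProb_nonneg (π : ∀ i, G.Behav i) (l : G.JointHist) {n : ℕ} (hl : l.length + n = G.D)
    (a : ∀ i, A i) : 0 ≤ G.actProb π l hl a :=
  Finset.prod_nonneg fun i _ => (π i (G.info i l hl)).2.1 _

theorem sum_actProb (π : ∀ i, G.Behav i) (l : G.JointHist) {n : ℕ} (hl : l.length + n = G.D) :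
    ∑ a, G.actProb π l hl a = 1 := by
  unfold actProb
  rw [← Fintype.prod_sum fun i (x : A i) => (π i (G.info i l hl)).1 x]
  exact Finset.prod_eq_one fun i _ => (π i (G.info i l hl)).2.2

theorem abs_sum_actProb_mul_le (π : ∀ i, G.Behav i) (l : G.JointHist) {n : ℕ}
    (hl : l.length + n = G.D) {f : (∀ i, A i) → ℝ} {M : ℝ} (hf : ∀ a, |f a| ≤ M) :
    |∑ a, G.actProb π l hl a * f a| ≤ M := by
  calc _ ≤ ∑ a, |G.actProb π l hl a * f a| := Finset.abs_sum_le_sum_abs _ _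
    _ ≤ ∑ a, G.actProb π l hl a * M := Finset.sum_le_sum fun a _ => by
        rw [abs_mul, abs_of_nonneg (G.actProb_nonneg π l hl a)]
        exact mul_le_mul_of_nonneg_left (hf a) (G.actProb_nonneg π l hl a)
    _ = M := by rw [← Finset.sum_mul, G.sum_actProb, one_mul]

/-- The sum `1 + γ + ⋯ + γ ^ n`. -/
noncomputable def partialGeom (n : ℕ) : ℝ := ∑ t ∈ Finset.range (n + 1), G.γ ^ t

theorem partialGeom_succ (n : ℕ) : G.partialGeom (n + 1) = 1 + G.γ * G.partialGeom n := by
  rw [partialGeom, geom_sum_succ, add_comm]; rfl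

theorem one_le_partialGeom (n : ℕ) : 1 ≤ G.partialGeom n := by
  cases n with
  | zero => simp [partialGeom]
  | succ n =>
    rw [partialGeom_succ]
    have : 0 ≤ G.partialGeom n := Finset.sum_nonneg fun t _ => pow_nonneg G.γ_nonneg t
    nlinarith [G.γ_nonneg]

theorem partialGeom_mono {m n : ℕ} (h : m ≤ n) : G.partialGeom m ≤ G.partialGeom n :=
  Finset.sum_le_sum_of_subset_of_nonneg (Finset.range_mono (by omega))
    fun t _ _ => pow_nonneg G.γ_nonneg t

variable {G} in
theorem sum_Z_coe (a : ∀ i, A i) (s s' : S) : ∑ o, (G.Z a s s' o : ℝ) = 1 := by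
  exact_mod_cast G.Z_sum a s s'

theorem Z_le_one (a : ∀ i, A i) (s s' : S) (o : JointObs O) : G.Z a s s' o ≤ 1 := by
  rw [← G.Z_sum a s s']
  exact Finset.single_le_sum (f := fun o => G.Z a s s' o) (fun _ _ => zero_le) (Finset.mem_univ o)

theorem abs_sum_Z_mul_le (a : ∀ i, A i) (s s' : S) {f : JointObs O → ℝ} {M : ℝ}
    (hf : ∀ o, |f o| ≤ M) : |∑ o, (G.Z a s s' o : ℝ) * f o| ≤ M := by
  calc _ ≤ ∑ o, |(G.Z a s s' o : ℝ) * f o| := Finset.abs_sum_le_sum_abs _ _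
    _ ≤ ∑ o, (G.Z a s s' o : ℝ) * M := Finset.sum_le_sum fun o _ => by
        rw [abs_mul, NNReal.abs_eq]
        exact mul_le_mul_of_nonneg_left (hf o) (NNReal.coe_nonneg _)
    _ = M := by rw [← Finset.sum_mul, sum_Z_coe, one_mul]

theorem abs_integral_le_of_forall {α : Type*} [MeasurableSpace α] {μ : Measure α}
    [IsProbabilityMeasure μ] {f : α → ℝ} {M : ℝ} (hf : ∀ x, |f x| ≤ M) : |∫ x, f x ∂μ| ≤ M := by
  have := norm_integral_le_of_norm_le_const (μ := μ)
    (Filter.Eventually.of_forall fun x => (Real.norm_eq_abs (f x)).le.trans (hf x))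
  simpa using this

theorem measurable_Z_right (a : ∀ i, A i) (s : S) (o : JointObs O) :
    Measurable fun s' => (G.Z a s s' o : ℝ) :=
  ((G.Z_measurable a o).comp measurable_prodMk_left).coe_nnreal_real

theorem measurable_value (π : ∀ i, G.Behav i) (i : N) (n : ℕ) :
    ∀ (l : G.JointHist) (hl : l.length + n = G.D), Measurable (G.value π i n l hl) := by
  induction n with
  | zero =>
    intro l hl
    change Measurable fun s => G.value π i 0 l hl s
    unfold value
    exact Finset.measurable_sum _ fun a _ => (G.r_measurable i a).const_mul _
  | succ n ih =>
    intro l hl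
    change Measurable fun s => G.value π i (n + 1) l hl s
    unfold value
    refine Finset.measurable_sum _ fun a _ => Measurable.const_mul ?_ _
    refine (G.r_measurable i a).add (Measurable.const_mul ?_ _)
    have h : Measurable fun p : S × S => ∑ o, (G.Z a p.1 p.2 o : ℝ) *
        G.value π i n ((a, o) :: l) (by rw [List.length_cons]; omega) p.2 :=
      Finset.measurable_sum _ fun o _ =>
        (G.Z_measurable a o).coe_nnreal_real.mul ((ih _ _).comp measurable_snd)
    exact (h.stronglyMeasurable.integral_kernel_prod_right' (κ := G.T a)).measurable

variable {i : N} {R : ℝ}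

theorem abs_value_le (hR : ∀ s a, |G.r i s a| ≤ R) (π : ∀ i, G.Behav i) (n : ℕ) :
    ∀ (l : G.JointHist) (hl : l.length + n = G.D) (s : S),
      |G.value π i n l hl s| ≤ R * G.partialGeom n := by
  induction n with
  | zero =>
    intro l hl s
    unfold value
    refine G.abs_sum_actProb_mul_le π l hl fun a => ?_
    simpa [partialGeom] using hR s a
  | succ n ih =>
    intro l hl s
    unfold value
    refine G.abs_sum_actProb_mul_le π l hl fun a => ?_
    rw [partialGeom_succ, mul_add, mul_one]
    refine (abs_add_le _ _).trans (add_le_add (hR s a) ?_)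
    rw [abs_mul, abs_of_nonneg G.γ_nonneg, mul_left_comm]
    exact mul_le_mul_of_nonneg_left (abs_integral_le_of_forall fun s' =>
      G.abs_sum_Z_mul_le a s s' fun o => ih _ _ _) G.γ_nonneg

theorem abs_utility_le (hR : ∀ s a, |G.r i s a| ≤ R) (π : ∀ i, G.Behav i) :
    |G.utility i π| ≤ R * G.partialGeom G.D :=
  abs_integral_le_of_forall fun s => G.abs_value_le hR π _ _ _ s

theorem abs_rewardEst_le (hR : ∀ s a, |G.r i s a| ≤ R) {C : ℕ} (hC : 0 < C)
    (b : G.Belief C) (a : ∀ i, A i) :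
    |G.rewardEst i b a| ≤ R := by
  have h1 : ∑ j, (G.normWeight b j : ℝ) = 1 := by exact_mod_cast G.sum_normWeight hC b
  calc _ ≤ ∑ j, |(G.normWeight b j : ℝ) * G.r i (b j).1 a| := Finset.abs_sum_le_sum_abs _ _
    _ ≤ ∑ j, (G.normWeight b j : ℝ) * R := Finset.sum_le_sum fun j _ => by
        rw [abs_mul, NNReal.abs_eq]
        exact mul_le_mul_of_nonneg_left (hR _ _) (NNReal.coe_nonneg _)
    _ = R := by rw [← Finset.sum_mul, h1, one_mul]

theorem abs_valueEst_le (hR : ∀ s a, |G.r i s a| ≤ R) {C : ℕ} (hC : 0 < C)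
    (π : ∀ i, G.Behav i) (n : ℕ) :
    ∀ (l : G.JointHist) (hl : l.length + n = G.D) (b : G.Belief C) (τ : G.Tree C n),
      |G.valueEst π i n l hl b τ| ≤ R * G.partialGeom n := by
  induction n with
  | zero =>
    intro l hl b τ
    unfold valueEst
    refine G.abs_sum_actProb_mul_le π l hl fun a => ?_
    simpa [partialGeom] using G.abs_rewardEst_le hR hC b a
  | succ n ih =>
    intro l hl b τ
    unfold valueEst
    refine G.abs_sum_actProb_mul_le π l hl fun a => ?_
    rw [partialGeom_succ, mul_add, mul_one]
    refine (abs_add_le _ _).trans (add_le_add (G.abs_rewardEst_le hR hC b a) ?_)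
    have hC' : (0 : ℝ) < C := by exact_mod_cast hC
    rw [abs_mul, abs_of_nonneg (div_nonneg G.γ_nonneg hC'.le), mul_left_comm, div_mul_eq_mul_div]
    rw [div_le_iff₀ hC', mul_assoc]
    refine mul_le_mul_of_nonneg_left ?_ G.γ_nonneg
    refine (Finset.abs_sum_le_sum_abs _ _).trans ?_
    refine (Finset.sum_le_sum fun k _ => ih _ _ _ _).trans_eq ?_
    simp [mul_comm]

theorem abs_utilityEst_le (hR : ∀ s a, |G.r i s a| ≤ R) {C : ℕ} (hC : 0 < C) (τ : G.CDIT C) (π : ∀ i, G.Behav i) :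
    |G.utilityEst τ i π| ≤ R * G.partialGeom G.D :=
  G.abs_valueEst_le hR hC π _ _ _ _ _

theorem measurable_rewardEst {C : ℕ} (a : ∀ i, A i) :
    Measurable fun b : G.Belief C => G.rewardEst i b a :=
  Finset.measurable_sum _ fun j _ => (G.measurable_normWeight j).coe_nnreal_real.mul
    ((G.r_measurable i a).comp (by fun_prop : Measurable fun b : G.Belief C => (b j).1))

theorem measurable_valueEst {C : ℕ} (π : ∀ i, G.Behav i) (n : ℕ) :
    ∀ (l : G.JointHist) (hl : l.length + n = G.D),
      Measurable fun p : G.Belief C × G.Tree C n => G.valueEst π i n l hl p.1 p.2 := by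
  induction n with
  | zero =>
    intro l hl
    unfold valueEst
    exact Finset.measurable_sum _ fun a _ =>
      ((G.measurable_rewardEst a).comp measurable_fst).const_mul _
  | succ n ih =>
    intro l hl
    unfold valueEst
    refine Finset.measurable_sum _ fun a _ => Measurable.const_mul ?_ _
    refine ((G.measurable_rewardEst a).comp measurable_fst).add (Measurable.const_mul ?_ _)
    refine Finset.measurable_sum _ fun k _ => ?_
    have h : Measurable fun q : JointObs O × (G.Belief C × G.Tree C n) =>
        G.valueEst π i n ((a, q.1) :: l) (by rw [List.length_cons]; omega) q.2.1 q.2.2 :=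
      measurable_from_prod_countable_right fun o => ih ((a, o) :: l) _
    have h' : Measurable fun q : (JointObs O × G.Belief C) × G.Tree C n =>
        G.valueEst π i n ((a, q.1.1) :: l) (by rw [List.length_cons]; omega) q.1.2 q.2 :=
      h.comp (by fun_prop : Measurable fun q : (JointObs O × G.Belief C) × G.Tree C n =>
        (q.1.1, (q.1.2, q.2)))
    exact h'.comp ((measurable_pi_apply (X := fun _ : (∀ i, A i) × Fin C =>
      (JointObs O × G.Belief C) × G.Tree C n) (a, k)).comp measurable_snd)

end POSG

namespace POSG

variable {N : Type uN} [Fintype N] [DecidableEq N] {S : Type uS} [MeasurableSpace S]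
  {A : N → Type uA} {O : N → Type uO}
  [∀ i, Fintype (A i)] [∀ i, Fintype (O i)] (G : POSG N S A O)

/-! ### Likelihoods and values of joint histories -/

theorem measurable_particleStep (a : ∀ i, A i) (o : JointObs O) :
    Measurable fun p : (S × ℝ≥0) × S => (p.2, p.1.2 * G.Z a p.1.1 p.2 o) :=
  measurable_snd.prodMk (measurable_fst.snd.mul
    ((G.Z_measurable a o).comp (by fun_prop : Measurable fun p : (S × ℝ≥0) × S => (p.1.1, p.2))))

theorem weightLaw_cons (a : ∀ i, A i) (o : JointObs O) (l : G.JointHist) :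
    G.weightLaw ((a, o) :: l) =
      (G.weightLaw l ⊗ₘ (G.T a).comap (Prod.fst : S × ℝ≥0 → S) measurable_fst).map
        fun p => (p.2, p.1.2 * G.Z a p.1.1 p.2 o) := rfl

instance isProbabilityMeasure_weightLaw (l : G.JointHist) :
    IsProbabilityMeasure (G.weightLaw l) := by
  induction l with
  | nil => exact Measure.isProbabilityMeasure_map (by fun_prop : Measurable _).aemeasurable
  | cons x l ih => exact Measure.isProbabilityMeasure_map (G.measurable_particleStep _ _).aemeasurable

theorem ae_weightLaw_cons {a : ∀ i, A i} {o : JointObs O} {l : G.JointHist} {p : S × ℝ≥0 → Prop}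
    (hp : MeasurableSet {x | p x}) : (∀ᵐ x ∂G.weightLaw ((a, o) :: l), p x) ↔
      ∀ᵐ x ∂G.weightLaw l, ∀ᵐ s' ∂G.T a x.1, p (s', x.2 * G.Z a x.1 s' o) := by
  rw [weightLaw_cons, ae_map_iff (G.measurable_particleStep a o).aemeasurable hp]
  exact Measure.ae_compProd_iff (G.measurable_particleStep a o hp)

theorem ae_weight_le_one (l : G.JointHist) : ∀ᵐ x ∂G.weightLaw l, x.2 ≤ 1 := by
  induction l with
  | nil =>
    unfold weightLaw
    rw [ae_map_iff (by fun_prop) (measurableSet_le measurable_snd measurable_const)]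
    simp
  | cons y l ih =>
    rw [G.ae_weightLaw_cons (measurableSet_le measurable_snd measurable_const)]
    filter_upwards [ih] with x hx
    exact Filter.Eventually.of_forall fun s' => mul_le_one' hx (G.Z_le_one _ _ _ _)

theorem integrable_weight_mul (l : G.JointHist) {f : S × ℝ≥0 → ℝ} (hf : Measurable f) {M : ℝ}
    (hM : ∀ x, |f x| ≤ M) : Integrable (fun x => (x.2 : ℝ) * f x) (G.weightLaw l) := by
  refine Integrable.of_bound (by fun_prop) M ?_
  filter_upwards [G.ae_weight_le_one l] with x hx
  rw [norm_mul, Real.norm_eq_abs, Real.norm_eq_abs, NNReal.abs_eq]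
  have : (x.2 : ℝ) ≤ 1 := by exact_mod_cast hx
  nlinarith [hM x, abs_nonneg (f x), x.2.coe_nonneg]

theorem integrable_weight (l : G.JointHist) :
    Integrable (fun x => (x.2 : ℝ)) (G.weightLaw l) := by
  simpa using G.integrable_weight_mul l (f := fun _ => 1) measurable_const (M := 1) (by simp)

/-- The probability of the observations of a joint history given its actions. -/
noncomputable def likelihood (l : G.JointHist) : ℝ := ∫ x, (x.2 : ℝ) ∂G.weightLaw l

theorem likelihood_nonneg (l : G.JointHist) : 0 ≤ G.likelihood l :=
  integral_nonneg fun x => x.2.coe_nonneg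

theorem likelihood_nil : G.likelihood [] = 1 := by
  unfold likelihood weightLaw
  rw [integral_map (by fun_prop) (by fun_prop)]
  simp

theorem lintegral_weight (l : G.JointHist) :
    ∫⁻ x, (x.2 : ℝ≥0∞) ∂G.weightLaw l = ENNReal.ofReal (G.likelihood l) := by
  unfold likelihood
  rw [ofReal_integral_eq_lintegral_ofReal (G.integrable_weight l)
    (Filter.Eventually.of_forall fun x => x.2.coe_nonneg)]
  simp

/-- The probability of the joint observation `o` after a transition from `s` via `a`. -/
noncomputable def obsLik (a : ∀ i, A i) (o : JointObs O) (s : S) : ℝ :=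
  ∫ s', (G.Z a s s' o : ℝ) ∂G.T a s

theorem abs_Z_mul_le (a : ∀ i, A i) (s s' : S) (o : JointObs O) {x M : ℝ} (hx : |x| ≤ M) :
    |(G.Z a s s' o : ℝ) * x| ≤ M := by
  rw [abs_mul, NNReal.abs_eq]
  have : (G.Z a s s' o : ℝ) ≤ 1 := by exact_mod_cast G.Z_le_one a s s' o
  nlinarith [abs_nonneg x, (G.Z a s s' o).coe_nonneg]

theorem integrable_Z_mul (a : ∀ i, A i) (s : S) (o : JointObs O) {f : S → ℝ} (hf : Measurable f)
    {M : ℝ} (hM : ∀ x, |f x| ≤ M) :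
    Integrable (fun s' => (G.Z a s s' o : ℝ) * f s') (G.T a s) :=
  Integrable.of_bound ((G.measurable_Z_right a s o).mul hf).aestronglyMeasurable M
    (Filter.Eventually.of_forall fun s' => G.abs_Z_mul_le a s s' o (hM s'))

theorem integrable_Z (a : ∀ i, A i) (s : S) (o : JointObs O) :
    Integrable (fun s' => (G.Z a s s' o : ℝ)) (G.T a s) := by
  simpa using G.integrable_Z_mul a s o (f := fun _ => 1) measurable_const (M := 1) (by simp)

theorem obsLik_nonneg (a : ∀ i, A i) (o : JointObs O) (s : S) : 0 ≤ G.obsLik a o s :=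
  integral_nonneg fun _ => NNReal.coe_nonneg _

theorem sum_obsLik (a : ∀ i, A i) (s : S) : ∑ o, G.obsLik a o s = 1 := by
  unfold obsLik
  rw [← integral_finsetSum _ fun o _ => G.integrable_Z a s o]
  simp [sum_Z_coe]

theorem obsLik_le_one (a : ∀ i, A i) (o : JointObs O) (s : S) : G.obsLik a o s ≤ 1 := by
  rw [← G.sum_obsLik a s]
  exact Finset.single_le_sum (f := fun o => G.obsLik a o s) (fun o _ => G.obsLik_nonneg a o s)
    (Finset.mem_univ o)

theorem measurable_integral_Z_mul (a : ∀ i, A i) (o : JointObs O) {f : S → ℝ}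
    (hf : Measurable f) : Measurable fun s => ∫ s', (G.Z a s s' o : ℝ) * f s' ∂G.T a s := by
  have h : Measurable fun p : S × S => (G.Z a p.1 p.2 o : ℝ) * f p.2 :=
    (G.Z_measurable a o).coe_nnreal_real.mul (hf.comp measurable_snd)
  exact (h.stronglyMeasurable.integral_kernel_prod_right' (κ := G.T a)).measurable

theorem measurable_obsLik (a : ∀ i, A i) (o : JointObs O) : Measurable (G.obsLik a o) := by
  have := G.measurable_integral_Z_mul a o (f := fun _ => 1) measurable_const
  simp only [mul_one] at this
  exact this

theorem abs_sum_obsLik_mul_le (a : ∀ i, A i) (s : S) {f : JointObs O → ℝ} {M : ℝ}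
    (hf : ∀ o, |f o| ≤ M) : |∑ o, G.obsLik a o s * f o| ≤ M := by
  calc _ ≤ ∑ o, |G.obsLik a o s * f o| := Finset.abs_sum_le_sum_abs _ _
    _ ≤ ∑ o, G.obsLik a o s * M := Finset.sum_le_sum fun o _ => by
        rw [abs_mul, abs_of_nonneg (G.obsLik_nonneg a o s)]
        exact mul_le_mul_of_nonneg_left (hf o) (G.obsLik_nonneg a o s)
    _ = M := by rw [← Finset.sum_mul, sum_obsLik, one_mul]

theorem integral_weight_mul_cons (a : ∀ i, A i) (o : JointObs O) (l : G.JointHist) {f : S → ℝ}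
    (hf : Measurable f) {M : ℝ} (hM : ∀ x, |f x| ≤ M) :
    ∫ x, (x.2 : ℝ) * f x.1 ∂G.weightLaw ((a, o) :: l) =
      ∫ x, (x.2 : ℝ) * ∫ s', (G.Z a x.1 s' o : ℝ) * f s' ∂G.T a x.1 ∂G.weightLaw l := by
  have hi := G.integrable_weight_mul ((a, o) :: l) (hf.comp measurable_fst) (fun x => hM x.1)
  have hm : Measurable fun x : S × ℝ≥0 => (x.2 : ℝ) * f x.1 := by fun_prop
  have hst := G.measurable_particleStep a o
  rw [weightLaw_cons] at hi ⊢
  rw [integral_map hst.aemeasurable hm.aestronglyMeasurable, Measure.integral_compProd (E := ℝ)]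
  · refine integral_congr_ae (Filter.Eventually.of_forall fun x => ?_)
    simp only [Kernel.comap_apply, NNReal.coe_mul, mul_assoc]
    rw [integral_const_mul]
  · exact (integrable_map_measure hm.aestronglyMeasurable hst.aemeasurable).1 hi

theorem likelihood_cons (a : ∀ i, A i) (o : JointObs O) (l : G.JointHist) :
    G.likelihood ((a, o) :: l) = ∫ x, (x.2 : ℝ) * G.obsLik a o x.1 ∂G.weightLaw l := by
  simpa [likelihood, obsLik] using
    G.integral_weight_mul_cons a o l (f := fun _ => 1) measurable_const (M := 1) (by simp)

theorem integrable_weight_mul_obsLik (a : ∀ i, A i) (o : JointObs O) (l : G.JointHist) :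
    Integrable (fun x => (x.2 : ℝ) * G.obsLik a o x.1) (G.weightLaw l) :=
  G.integrable_weight_mul l ((G.measurable_obsLik a o).comp measurable_fst) (M := 1) fun x => by
    exact (abs_of_nonneg (G.obsLik_nonneg a o _)).trans_le (G.obsLik_le_one a o _)

/-- The observation probabilities after each state add up to one. This cancels the factor `1 / p` of
the change of measure. -/
theorem sum_likelihood_cons (a : ∀ i, A i) (l : G.JointHist) :
    ∑ o, G.likelihood ((a, o) :: l) = G.likelihood l := by
  simp_rw [likelihood_cons]
  rw [← integral_finsetSum _ fun o _ => G.integrable_weight_mul_obsLik a o l]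
  simp_rw [← Finset.mul_sum, sum_obsLik, mul_one]
  rfl

/-- The value of a joint history: the mean of the values of the states, weighted by likelihood. -/
noncomputable def histValue (π : ∀ i, G.Behav i) (i : N) (n : ℕ) (l : G.JointHist)
    (hl : l.length + n = G.D) : ℝ :=
  (∫ x, (x.2 : ℝ) * G.value π i n l hl x.1 ∂G.weightLaw l) / G.likelihood l

theorem histValue_nil (π : ∀ i, G.Behav i) (i : N) :
    G.histValue π i G.D [] (by simp) = G.utility i π := by
  unfold histValue
  rw [likelihood_nil, div_one]
  unfold weightLaw utility
  rw [integral_map (by fun_prop)]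
  · simp
  · have := G.measurable_value π i G.D [] (by simp)
    exact Measurable.aestronglyMeasurable (by fun_prop)

/-- At a history of likelihood zero the weights vanish almost surely, so the identity survives the
division by zero in `histValue`. -/
theorem likelihood_mul_histValue (π : ∀ i, G.Behav i) (i : N) (n : ℕ) (l : G.JointHist)
    (hl : l.length + n = G.D) : G.likelihood l * G.histValue π i n l hl =
      ∫ x, (x.2 : ℝ) * G.value π i n l hl x.1 ∂G.weightLaw l := by
  unfold histValue
  rcases eq_or_ne (G.likelihood l) 0 with h | h
  · rw [h, zero_mul]
    have h0 := (integral_eq_zero_iff_of_nonneg (fun x : S × ℝ≥0 => x.2.coe_nonneg)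
      (G.integrable_weight l)).1 h
    rw [integral_congr_ae (g := fun _ => (0 : ℝ)), integral_zero]
    filter_upwards [h0] with x hx
    rw [show (x.2 : ℝ) = 0 from hx, zero_mul]
  · rw [mul_div_cancel₀ _ h]

variable {i : N} {R : ℝ}

theorem abs_histValue_le (hR : ∀ s a, |G.r i s a| ≤ R) (hR0 : 0 ≤ R) (π : ∀ i, G.Behav i) (n : ℕ)
    (l : G.JointHist) (hl : l.length + n = G.D) :
    |G.histValue π i n l hl| ≤ R * G.partialGeom n := by
  have hM : 0 ≤ R * G.partialGeom n :=
    mul_nonneg hR0 (zero_le_one.trans (G.one_le_partialGeom n))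
  unfold histValue
  rw [abs_div, abs_of_nonneg (G.likelihood_nonneg l)]
  refine div_le_of_le_mul₀ (G.likelihood_nonneg l) hM ?_
  refine abs_integral_le_integral_abs.trans ?_
  rw [likelihood, ← integral_const_mul]
  have hm := (G.measurable_value π i n l hl).comp 
    (measurable_fst : Measurable (Prod.fst : S × ℝ≥0 → S))
  refine integral_mono (G.integrable_weight_mul l hm fun x => G.abs_value_le hR π n l hl x.1).abs
    ((G.integrable_weight l).const_mul _) fun x => ?_
  simp only [abs_mul, NNReal.abs_eq]
  rw [mul_comm]
  exact mul_le_mul_of_nonneg_right (G.abs_value_le hR π n l hl x.1) x.2.coe_nonneg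

/-- The reward in the state `s` for the action `a` and the discounted mean of the values of the
joint histories that follow. -/
noncomputable def lookahead (π : ∀ i, G.Behav i) (i : N) (n : ℕ) (l : G.JointHist)
    (hl : l.length + (n + 1) = G.D) (a : ∀ i, A i) (s : S) : ℝ :=
  G.r i s a + G.γ * ∑ o, G.obsLik a o s *
    G.histValue π i n ((a, o) :: l) (by rw [List.length_cons]; omega)

theorem measurable_lookahead (π : ∀ i, G.Behav i) (i : N) (n : ℕ) (l : G.JointHist)
    (hl : l.length + (n + 1) = G.D) (a : ∀ i, A i) : Measurable (G.lookahead π i n l hl a) :=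
  (G.r_measurable i a).add (Measurable.const_mul (Finset.measurable_sum _ fun o _ =>
    (G.measurable_obsLik a o).mul_const _) _)

theorem abs_lookahead_le (hR : ∀ s a, |G.r i s a| ≤ R) (hR0 : 0 ≤ R) (π : ∀ i, G.Behav i) (n : ℕ)
    (l : G.JointHist) (hl : l.length + (n + 1) = G.D) (a : ∀ i, A i) (s : S) :
    |G.lookahead π i n l hl a s| ≤ R * G.partialGeom (n + 1) := by
  unfold lookahead
  rw [partialGeom_succ, mul_add, mul_one]
  refine (abs_add_le _ _).trans (add_le_add (hR s a) ?_)
  rw [abs_mul, abs_of_nonneg G.γ_nonneg, mul_left_comm]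
  exact mul_le_mul_of_nonneg_left (G.abs_sum_obsLik_mul_le a s fun o =>
    G.abs_histValue_le hR hR0 π n _ _) G.γ_nonneg

/-- The weighted mean of `lookahead`, averaged over the actions, is the value of the history. -/
theorem integral_weight_mul_lookahead (hR : ∀ s a, |G.r i s a| ≤ R) (π : ∀ i, G.Behav i) (n : ℕ)
    (l : G.JointHist) (hl : l.length + (n + 1) = G.D) (a : ∀ i, A i) :
    ∫ x, (x.2 : ℝ) * G.lookahead π i n l hl a x.1 ∂G.weightLaw l =
      ∫ x, (x.2 : ℝ) * (G.r i x.1 a + G.γ * ∫ s', ∑ o, (G.Z a x.1 s' o : ℝ) *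
        G.value π i n ((a, o) :: l) (by rw [List.length_cons]; omega) s' ∂G.T a x.1)
        ∂G.weightLaw l := by
  have hr := G.integrable_weight_mul l ((G.r_measurable i a).comp measurable_fst)
    (fun x => hR x.1 a)
  simp only [Function.comp_apply] at hr
  have hlen : ∀ o : JointObs O, ((a, o) :: l).length + n = G.D := fun o => by
    rw [List.length_cons]; omega
  have e1 : ∀ x : S × ℝ≥0, (x.2 : ℝ) * G.lookahead π i n l hl a x.1 =
      x.2 * G.r i x.1 a + G.γ * ∑ o, (x.2 * G.obsLik a o x.1) *
        G.histValue π i n ((a, o) :: l) (hlen o) := fun x => by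
    unfold lookahead
    rw [mul_add, mul_left_comm, Finset.mul_sum]
    simp_rw [mul_assoc]
  have e2 : ∀ x : S × ℝ≥0, (x.2 : ℝ) * (G.r i x.1 a + G.γ * ∫ s', ∑ o, (G.Z a x.1 s' o : ℝ) *
        G.value π i n ((a, o) :: l) (hlen o) s' ∂G.T a x.1) =
      x.2 * G.r i x.1 a + G.γ * ∑ o, x.2 * ∫ s', (G.Z a x.1 s' o : ℝ) *
        G.value π i n ((a, o) :: l) (hlen o) s' ∂G.T a x.1 := fun x => by
    rw [mul_add, mul_left_comm, integral_finsetSum _ fun o _ => G.integrable_Z_mul a x.1 o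
      (G.measurable_value π i n _ (hlen o)) (G.abs_value_le hR π n _ (hlen o)), Finset.mul_sum]
  have i1 : ∀ o, Integrable (fun x => ((x.2 : ℝ) * G.obsLik a o x.1) *
        G.histValue π i n ((a, o) :: l) (hlen o)) (G.weightLaw l) := fun o =>
    (G.integrable_weight_mul_obsLik a o l).mul_const _
  have i2 : ∀ o, Integrable (fun x => (x.2 : ℝ) * ∫ s', (G.Z a x.1 s' o : ℝ) *
        G.value π i n ((a, o) :: l) (hlen o) s' ∂G.T a x.1) (G.weightLaw l) := fun o =>
    G.integrable_weight_mul l ((G.measurable_integral_Z_mul a o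
      (G.measurable_value π i n _ (hlen o))).comp measurable_fst) fun x =>
        abs_integral_le_of_forall fun s' => G.abs_Z_mul_le a x.1 s' o
          (G.abs_value_le hR π n _ (hlen o) s')
  simp_rw [e1, e2]
  rw [integral_add hr ((integrable_finsetSum _ fun o _ => i1 o).const_mul _),
    integral_add hr ((integrable_finsetSum _ fun o _ => i2 o).const_mul _),
    integral_const_mul, integral_const_mul, integral_finsetSum _ fun o _ => i1 o,
    integral_finsetSum _ fun o _ => i2 o]
  congr 2
  refine Finset.sum_congr rfl fun o _ => ?_
  -- Both summands are the weighted integral of the value along the history extended by `(a, o)`.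
  rw [integral_mul_const, ← likelihood_cons, likelihood_mul_histValue,
    G.integral_weight_mul_cons a o l (G.measurable_value π i n _ (hlen o))
      (G.abs_value_le hR π n _ (hlen o))]

/-- The essential supremum of the weight over its mean is one of the divergences in the maximum.
Ranges in Hoeffding's inequality thus scale with the likelihood, and no lower bound on likelihoods
enters the constants. -/
theorem ae_weight_le (hd : 0 < G.dInfMax) (l : G.JointHist) (hl : l.length ≤ G.D) :
    ∀ᵐ x ∂G.weightLaw l, (x.2 : ℝ) ≤ G.dInfMax * G.likelihood l := by
  set M : ℝ≥0∞ := ⨆ l : {l : G.JointHist // l.length ≤ G.D}, G.dInf l.1 with hM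
  -- `toReal` sends `⊤` to zero, so `hd` also provides finiteness.
  have hMt : M ≠ ⊤ := fun h => by
    unfold dInfMax at hd; rw [← hM, h] at hd; simp at hd
  have h1 : G.dInf l ≤ M := le_iSup (fun l : {l : G.JointHist // l.length ≤ G.D} => G.dInf l.1)
    ⟨l, hl⟩
  unfold dInf at h1
  rw [lintegral_weight, ENNReal.div_le_iff_le_mul (Or.inr hMt) (Or.inl ENNReal.ofReal_ne_top)]
    at h1
  filter_upwards [ENNReal.ae_le_essSup (μ := G.weightLaw l) fun x : S × ℝ≥0 => (x.2 : ℝ≥0∞)]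
    with x hx
  have h2 := hx.trans h1
  have h3 : M = ENNReal.ofReal G.dInfMax := (ENNReal.ofReal_toReal hMt).symm
  rw [h3, ← ENNReal.ofReal_mul hd.le, ← ENNReal.ofReal_coe_nnreal] at h2
  exact (ENNReal.ofReal_le_ofReal_iff (mul_nonneg hd.le (G.likelihood_nonneg l))).1 h2

/-- Given the particle `x`, the product is the conditional mean of its weight after one more step,
so it inherits the almost sure bound on weights along the extended history. -/
theorem ae_weight_mul_obsLik_le (hd : 0 < G.dInfMax) (a : ∀ i, A i) (o : JointObs O)
    (l : G.JointHist) (hl : l.length + 1 ≤ G.D) :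
    ∀ᵐ x ∂G.weightLaw l, (x.2 : ℝ) * G.obsLik a o x.1 ≤
      G.dInfMax * G.likelihood ((a, o) :: l) := by
  have h := G.ae_weight_le hd ((a, o) :: l) (by simpa using hl)
  rw [G.ae_weightLaw_cons (measurableSet_le (by fun_prop) measurable_const)] at h
  filter_upwards [h] with x hx
  unfold obsLik
  rw [← integral_const_mul]
  refine (integral_mono_ae ((G.integrable_Z a x.1 o).const_mul _) (integrable_const _) ?_).trans_eq
    (b := ∫ _, G.dInfMax * G.likelihood ((a, o) :: l) ∂G.T a x.1) (by simp)
  filter_upwards [hx] with s' hs'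
  simpa using hs'

end POSG

namespace POSG

variable {N : Type uN} [Fintype N] [DecidableEq N] {S : Type uS} [MeasurableSpace S]
  {A : N → Type uA} {O : N → Type uO}
  [∀ i, Fintype (A i)] [∀ i, Fintype (O i)] (G : POSG N S A O)

/-! ### Particle beliefs along a fixed joint history -/

/-- The law of `C` independent weighted particles along the joint history `l`. -/
noncomputable def beliefLaw (C : ℕ) (l : G.JointHist) : Measure (G.Belief C) :=
  Measure.pi fun _ : Fin C => G.weightLaw l

instance (C : ℕ) (l : G.JointHist) : IsProbabilityMeasure (G.beliefLaw C l) := by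
  unfold beliefLaw; infer_instance

/-- Inequalities between the constants that make all tail bounds at most `exp (-(C * K))`, where
`d` bounds the ratio of likelihoods to their means, `M` bounds values and `lam` is the error. -/
structure TailBounds (C : ℕ) (d M lam K : ℝ) : Prop where
  d_pos : 0 < d
  M_pos : 0 < M
  lam_pos : 0 < lam
  sq_le_card : d ^ 2 ≤ 4 * C
  le_weight : K ≤ 1 / (2 * d ^ 2)
  le_estimate : K ≤ lam ^ 2 / (8 * (M * d) ^ 2)
  le_sample : K ≤ lam ^ 2 / (2 * M ^ 2)

/-- The total weight is more than half its mean and the weighted sum of the deviations `f - v` is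
small. -/
def GoodBelief {C : ℕ} (p lam : ℝ) (f : S → ℝ) (v : ℝ) (b : G.Belief C) : Prop :=
  C * p / 2 < ∑ j, ((b j).2 : ℝ) ∧ |∑ j, ((b j).2 : ℝ) * (f (b j).1 - v)| < C * (lam * p / 2)

variable {G} in
theorem sum_normWeight_mul {C : ℕ} (b : G.Belief C) (hb : 0 < ∑ j, ((b j).2 : ℝ)) (f : S → ℝ) :
    ∑ j, (G.normWeight b j : ℝ) * f (b j).1 =
      (∑ j, ((b j).2 : ℝ) * f (b j).1) / ∑ j, ((b j).2 : ℝ) := by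
  have h0 : ∑ k, (b k).2 ≠ 0 := fun h => by
    have : ((∑ k, (b k).2 : ℝ≥0) : ℝ) = 0 := by rw [h]; rfl
    rw [NNReal.coe_sum] at this
    exact hb.ne' this
  simp only [normWeight, h0, if_false, NNReal.coe_div, NNReal.coe_sum]
  rw [Finset.sum_div]
  exact Finset.sum_congr rfl fun j _ => by ring

variable {G} in
theorem GoodBelief.sum_pos {C : ℕ} {p lam v : ℝ} {f : S → ℝ} {b : G.Belief C} (hp : 0 ≤ p)
    (h : G.GoodBelief p lam f v b) : 0 < ∑ j, ((b j).2 : ℝ) :=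
  lt_of_le_of_lt (by positivity) h.1

variable {G} in
-- The error is the quotient of the two sums in `GoodBelief`: at most `lam * p / 2` over at least `p
-- / 2`, after division by `C`.
theorem GoodBelief.abs_estimate_sub_le {C : ℕ} {p lam v : ℝ} {f : S → ℝ} {b : G.Belief C}
    (hp : 0 ≤ p) (hlam : 0 ≤ lam) (h : G.GoodBelief p lam f v b) :
    |∑ j, (G.normWeight b j : ℝ) * f (b j).1 - v| ≤ lam := by
  have hW := h.sum_pos hp
  rw [sum_normWeight_mul b hW, div_sub' hW.ne', abs_div, abs_of_pos hW, div_le_iff₀ hW]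
  have : ∑ j, ((b j).2 : ℝ) * f (b j).1 - (∑ j, ((b j).2 : ℝ)) * v =
      ∑ j, ((b j).2 : ℝ) * (f (b j).1 - v) := by
    rw [Finset.sum_mul, ← Finset.sum_sub_distrib]
    exact Finset.sum_congr rfl fun j _ => by ring
  rw [this]
  refine h.2.le.trans ?_
  nlinarith [h.1]

theorem obsProb_eq {C : ℕ} (b : G.Belief C) (a : ∀ i, A i) (o : JointObs O) :
    G.obsProb b a o = ENNReal.ofReal (∑ j, (G.normWeight b j : ℝ) * G.obsLik a o (b j).1) := by
  unfold obsProb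
  rw [ENNReal.ofReal_sum_of_nonneg fun j _ =>
    mul_nonneg (NNReal.coe_nonneg _) (G.obsLik_nonneg a o _)]
  refine Finset.sum_congr rfl fun j _ => ?_
  rw [ENNReal.ofReal_mul (NNReal.coe_nonneg _), ENNReal.ofReal_coe_nnreal, obsLik,
    ofReal_integral_eq_lintegral_ofReal (G.integrable_Z a _ o)
      (Filter.Eventually.of_forall fun _ => NNReal.coe_nonneg _)]
  simp

theorem toReal_obsProb {C : ℕ} (b : G.Belief C) (a : ∀ i, A i) (o : JointObs O) :
    (G.obsProb b a o).toReal = ∑ j, (G.normWeight b j : ℝ) * G.obsLik a o (b j).1 := by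
  rw [obsProb_eq, ENNReal.toReal_ofReal (Finset.sum_nonneg fun j _ =>
    mul_nonneg (NNReal.coe_nonneg _) (G.obsLik_nonneg a o _))]

variable {G} in
-- Replacing the random normalization by its lower bound `C * p / 2` leaves an unnormalized average
-- of independent terms. This is the density bound in the change of measure.
theorem GoodBelief.obsProb_le {C : ℕ} {p lam v : ℝ} {f : S → ℝ} {b : G.Belief C}
    (hC : 0 < C) (hp : 0 < p) (h : G.GoodBelief p lam f v b) (a : ∀ i, A i) (o : JointObs O) :
    G.obsProb b a o ≤ ENNReal.ofReal (2 / p) *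
      ENNReal.ofReal ((∑ j, ((b j).2 : ℝ) * G.obsLik a o (b j).1) / C) := by
  have hW := h.sum_pos hp.le
  have hC' : (0 : ℝ) < C := by exact_mod_cast hC
  rw [obsProb_eq, sum_normWeight_mul b hW, ← ENNReal.ofReal_mul (by positivity)]
  refine ENNReal.ofReal_le_ofReal ?_
  have h0 : 0 ≤ ∑ j, ((b j).2 : ℝ) * G.obsLik a o (b j).1 :=
    Finset.sum_nonneg fun j _ => mul_nonneg (NNReal.coe_nonneg _) (G.obsLik_nonneg a o _)
  rw [div_mul_div_comm, div_le_div_iff₀ hW (by positivity)]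
  nlinarith [h.1, mul_le_mul_of_nonneg_left h.1.le h0]

/-- The sampling law of observations is itself a normalized particle mean, of `obsLik`. The reward
error and the observation error thus become a single weighted estimate of one function of the state.
-/
theorem rewardEst_add_eq_sum_lookahead {C : ℕ} (π : ∀ i, G.Behav i) (i : N) (n : ℕ)
    (l : G.JointHist) (hl : l.length + (n + 1) = G.D) (a : ∀ i, A i) (b : G.Belief C) :
    G.rewardEst i b a + G.γ * ∑ o, (G.obsProb b a o).toReal *
        G.histValue π i n ((a, o) :: l) (by rw [List.length_cons]; omega) =
      ∑ j, (G.normWeight b j : ℝ) * G.lookahead π i n l hl a (b j).1 := by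
  simp_rw [toReal_obsProb, rewardEst, lookahead, Finset.sum_mul, mul_add,
    Finset.sum_add_distrib, Finset.mul_sum]
  congr 1
  rw [Finset.sum_comm]
  exact Finset.sum_congr rfl fun j _ => Finset.sum_congr rfl fun o _ => by ring

variable {G} {C : ℕ} {lam K M : ℝ}

theorem ofReal_exp_neg_le {x y : ℝ} (h : y ≤ x) :
    ENNReal.ofReal (Real.exp (-x)) ≤ ENNReal.ofReal (Real.exp (-y)) :=
  ENNReal.ofReal_le_ofReal (Real.exp_le_exp.2 (neg_le_neg h))

/-- One tail for the total weight and two tails for the weighted sum, whose mean vanishes by `hfv`,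
give the factor 3. -/
theorem beliefLaw_not_good_le (hK : TailBounds C G.dInfMax M lam K) {l : G.JointHist}
    (hl : l.length ≤ G.D) (hp : 0 < G.likelihood l) {f : S → ℝ} (hf : Measurable f)
    (hfM : ∀ s, |f s| ≤ M) {v : ℝ} (hv : |v| ≤ M)
    (hfv : ∫ x, (x.2 : ℝ) * f x.1 ∂G.weightLaw l = G.likelihood l * v) :
    G.beliefLaw C l {b | ¬ G.GoodBelief (G.likelihood l) lam f v b} ≤
      3 * ENNReal.ofReal (Real.exp (-(C * K))) := by
  set p := G.likelihood l with hpdef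
  have hd := hK.d_pos
  have hM := hK.M_pos
  have hlam := hK.lam_pos
  set d := G.dInfMax with hddef
  have hw := G.ae_weight_le hd l hl
  have hm1 : Measurable fun x : S × ℝ≥0 => (x.2 : ℝ) := by fun_prop
  have t1 := measure_pi_sum_le_le (μ := fun _ : Fin C => G.weightLaw l)
    (e := fun k : Fin C => k) Function.injective_id (fun _ => rfl) hm1 (lo := 0) (B := d * p)
    (by positivity) (by
      filter_upwards [hw] with x hx
      exact ⟨x.2.coe_nonneg, by simpa using hx⟩) (η := p / 2) (by positivity)
  -- Centring `f` at `v` before weighting keeps the range at `2 * M * (d * p)`: the weight lies in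
  -- `[0, d * p]` and `f - v` in `[-(M + v), M - v]`.
  have hm2 : Measurable fun x : S × ℝ≥0 => (x.2 : ℝ) * (f x.1 - v) := by fun_prop
  have t2 := measure_pi_abs_sum_ge_le (μ := fun _ : Fin C => G.weightLaw l)
    (e := fun k : Fin C => k) Function.injective_id (fun _ => rfl) hm2 (lo := -(d * p * (M + v)))
    (B := 2 * M * (d * p)) (by positivity) (by
      filter_upwards [hw] with x hx
      have h1 := abs_le.1 (hfM x.1)
      have h2 := abs_le.1 hv
      have h3 := x.2.coe_nonneg
      constructor <;> nlinarith) (η := lam * p / 2) (by positivity)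
  have hmean : ∫ x, (x.2 : ℝ) * (f x.1 - v) ∂G.weightLaw l = 0 := by
    simp_rw [mul_sub]
    have hi := G.integrable_weight_mul l (hf.comp measurable_fst) fun x => hfM x.1
    simp only [Function.comp_apply] at hi
    rw [integral_sub hi ((G.integrable_weight l).mul_const v), integral_mul_const, hfv]
    exact sub_self _
  rw [hmean] at t2
  change Measure.pi (fun _ : Fin C => G.weightLaw l)
    {ω | ∑ k, (((ω k).2 : ℝ) - p) ≤ _} ≤ _ at t1
  simp only [Fintype.card_fin, sub_zero] at t1 t2
  have e1 : ENNReal.ofReal (Real.exp (-(2 * C * (p / 2) ^ 2 / (d * p) ^ 2))) ≤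
      ENNReal.ofReal (Real.exp (-(C * K))) := by
    refine ofReal_exp_neg_le ?_
    have : 2 * C * (p / 2) ^ 2 / (d * p) ^ 2 = C * (1 / (2 * d ^ 2)) := by field_simp
    rw [this]
    exact mul_le_mul_of_nonneg_left hK.le_weight (Nat.cast_nonneg C)
  have e2 : ENNReal.ofReal (Real.exp (-(2 * C * (lam * p / 2) ^ 2 / (2 * M * (d * p)) ^ 2))) ≤
      ENNReal.ofReal (Real.exp (-(C * K))) := by
    refine ofReal_exp_neg_le ?_
    have : 2 * C * (lam * p / 2) ^ 2 / (2 * M * (d * p)) ^ 2 =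
        C * (lam ^ 2 / (8 * (M * d) ^ 2)) := by field_simp; ring
    rw [this]
    exact mul_le_mul_of_nonneg_left hK.le_estimate (Nat.cast_nonneg C)
  have hsub : {b | ¬ G.GoodBelief (C := C) p lam f v b} ⊆
      {ω | ∑ k, (((ω k).2 : ℝ) - p) ≤ -(C * (p / 2))} ∪
      {ω | C * (lam * p / 2) ≤ |∑ k, ((ω k).2 : ℝ) * (f (ω k).1 - v)|} := by
    intro b hb
    by_contra hcon
    simp only [Set.mem_union, Set.mem_ofPred_eq, not_or, not_le] at hcon
    refine hb ⟨?_, hcon.2⟩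
    have := hcon.1
    rw [Finset.sum_sub_distrib] at this
    simp only [Finset.sum_const, Finset.card_univ, Fintype.card_fin, nsmul_eq_mul] at this
    linarith
  calc _ ≤ _ := (measure_mono hsub).trans (measure_union_le _ _)
    _ ≤ ENNReal.ofReal (Real.exp (-(C * K))) + 2 * ENNReal.ofReal (Real.exp (-(C * K))) :=
        add_le_add (t1.trans e1) (t2.trans (by gcongr))
    _ = _ := by ring

theorem measurable_update_left (a : ∀ i, A i) (o : JointObs O) :
    Measurable fun p : G.Belief C × (Fin C → S) => G.update a p.1 o p.2 :=
  (G.measurable_update a).snd.comp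
    (by fun_prop : Measurable fun p : G.Belief C × (Fin C → S) => (p.1, (o, p.2)))

/-- With the observation held fixed, moving and reweighting act on each particle separately, so
independence of the weighted particles is preserved. -/
theorem lintegral_moveKernel_update (a : ∀ i, A i) (o : JointObs O) (l : G.JointHist)
    {Φ : G.Belief C → ℝ≥0∞} (hΦ : Measurable Φ) :
    ∫⁻ b, ∫⁻ s', Φ (G.update a b o s') ∂G.moveKernel C a b ∂G.beliefLaw C l =
      ∫⁻ b, Φ b ∂G.beliefLaw C ((a, o) :: l) := by
  have h := pi_compProd_map (ι := Fin C) (G.weightLaw l)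
    ((G.T a).comap (Prod.fst : S × ℝ≥0 → S) measurable_fst) (G.measurable_particleStep a o)
  have hu : Measurable fun p : G.Belief C × (Fin C → S) => G.update a p.1 o p.2 :=
    measurable_update_left a o
  change (G.beliefLaw C l ⊗ₘ G.moveKernel C a).map (fun p => G.update a p.1 o p.2) =
    G.beliefLaw C ((a, o) :: l) at h
  rw [← h, lintegral_map hΦ hu]
  exact (Measure.lintegral_compProd (hΦ.comp hu)).symm

/-- The expected contribution of a joint observation: the likelihood of the observation under the
simulated particles is at most twice its mean, up to an exponentially small excess. -/
theorem lintegral_obs_mul_le [NeZero C] (hK : TailBounds C G.dInfMax M lam K)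
    {l : G.JointHist} (hl : l.length + 1 ≤ G.D) (a : ∀ i, A i) (o : JointObs O)
    {Φ : G.Belief C → ℝ≥0∞} (hΦ : Measurable Φ) (hΦ1 : ∀ b, Φ b ≤ 1) :
    ∫⁻ b, ENNReal.ofReal ((∑ j, ((b j).2 : ℝ) * G.obsLik a o (b j).1) / C) *
        ∫⁻ s', Φ (G.update a b o s') ∂G.moveKernel C a b ∂G.beliefLaw C l ≤
      ENNReal.ofReal (G.likelihood ((a, o) :: l)) *
        (2 * ∫⁻ b, Φ b ∂G.beliefLaw C ((a, o) :: l) + ENNReal.ofReal (Real.exp (-(C * K)))) := by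
  set p := G.likelihood ((a, o) :: l) with hpdef
  have hd := hK.d_pos
  set d := G.dInfMax with hddef
  have hw := G.ae_weight_mul_obsLik_le hd a o l hl
  have hqm : Measurable fun x : S × ℝ≥0 => (x.2 : ℝ) * G.obsLik a o x.1 :=
    measurable_snd.coe_nnreal_real.mul ((G.measurable_obsLik a o).comp measurable_fst)
  have hq0 : ∀ x : S × ℝ≥0, 0 ≤ (x.2 : ℝ) * G.obsLik a o x.1 := fun x =>
    mul_nonneg x.2.coe_nonneg (G.obsLik_nonneg a o _)
  have hmk : Measurable fun b => ∫⁻ s', Φ (G.update a b o s') ∂G.moveKernel C a b :=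
    (hΦ.comp (measurable_update_left a o)).lintegral_kernel_prod_right' (κ := G.moveKernel C a)
  have hk1 : ∀ b, ∫⁻ s', Φ (G.update a b o s') ∂G.moveKernel C a b ≤ 1 := fun b =>
    (lintegral_mono fun s' => hΦ1 _).trans_eq (by simp)
  -- For an observation of likelihood zero the almost sure bound `d * p` is zero, and so is the
  -- integrand almost everywhere.
  rcases (G.likelihood_nonneg ((a, o) :: l)).eq_or_lt with hp | hp
  · rw [← hpdef] at hp
    rw [← hp, ENNReal.ofReal_zero, zero_mul, nonpos_iff_eq_zero]
    rw [← hpdef, ← hp, mul_zero] at hw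
    have hall : ∀ᵐ b ∂G.beliefLaw C l, ∀ j, ((b j).2 : ℝ) * G.obsLik a o (b j).1 ≤ 0 :=
      ae_all_iff.2 fun j =>
        (measurePreserving_eval (fun _ : Fin C => G.weightLaw l) j).quasiMeasurePreserving.ae hw
    rw [lintegral_congr_ae (g := fun _ => (0 : ℝ≥0∞)), lintegral_zero]
    filter_upwards [hall] with b hb
    rw [ENNReal.ofReal_of_nonpos, zero_mul]
    exact div_nonpos_of_nonpos_of_nonneg (Finset.sum_nonpos fun j _ => hb j) (Nat.cast_nonneg C)
  · have hC : 0 < C := NeZero.pos C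
    have : Nonempty (Fin C) := ⟨⟨0, hC⟩⟩
    have hmean : ∫ x, (x.2 : ℝ) * G.obsLik a o x.1 ∂G.weightLaw l = p :=
      (G.likelihood_cons a o l).symm
    rw [← hpdef] at hp
    have hex := lintegral_pi_excess_le (μ := fun _ : Fin C => G.weightLaw l)
      (e := fun k : Fin C => k) Function.injective_id (fun _ => rfl) hqm (B := d * p)
      (by filter_upwards [hw] with x hx using ⟨hq0 x, hx⟩) (by rw [hmean]; exact hp) (by
        rw [hmean, Fintype.card_fin]
        nlinarith [mul_le_mul_of_nonneg_right hK.sq_le_card (sq_nonneg p)])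
    rw [hmean, Fintype.card_fin] at hex
    have e1 : ENNReal.ofReal (p * Real.exp (-(2 * C * p ^ 2 / (d * p) ^ 2))) ≤
        ENNReal.ofReal p * ENNReal.ofReal (Real.exp (-(C * K))) := by
      rw [ENNReal.ofReal_mul hp.le]
      refine mul_le_mul_right (ofReal_exp_neg_le ?_) _
      have h2 : 2 * C * p ^ 2 / (d * p) ^ 2 = C * (2 / d ^ 2) := by field_simp
      rw [h2]
      refine mul_le_mul_of_nonneg_left (hK.le_weight.trans ?_) (Nat.cast_nonneg C)
      rw [div_le_div_iff₀ (by positivity) (by positivity)]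
      nlinarith [sq_nonneg d]
    -- The average `y` is at most `2 * p` plus the positive part of `y - 2 * p`. In the first part
    -- `Φ` gets integrated against independent particles; in the second the inner integral is
    -- bounded by one and only the mean excess remains.
    calc _ ≤ ∫⁻ b, (ENNReal.ofReal (2 * p) * ∫⁻ s', Φ (G.update a b o s') ∂G.moveKernel C a b) +
            ENNReal.ofReal ((∑ j, ((b j).2 : ℝ) * G.obsLik a o (b j).1) / C - 2 * p)
            ∂G.beliefLaw C l := by
          refine lintegral_mono fun b => ?_
          set y := (∑ j, ((b j).2 : ℝ) * G.obsLik a o (b j).1) / C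
          have hy : ENNReal.ofReal y ≤ ENNReal.ofReal (2 * p) + ENNReal.ofReal (y - 2 * p) := by
            have := ENNReal.ofReal_add_le (p := 2 * p) (q := y - 2 * p)
            rwa [add_sub_cancel] at this
          refine (mul_le_mul_left hy _).trans ?_
          rw [add_mul]
          exact add_le_add le_rfl (mul_le_of_le_one_right' (hk1 b))
      _ = ENNReal.ofReal (2 * p) * ∫⁻ b, Φ b ∂G.beliefLaw C ((a, o) :: l) +
            ∫⁻ b, ENNReal.ofReal ((∑ j, ((b j).2 : ℝ) * G.obsLik a o (b j).1) / C - 2 * p)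
            ∂G.beliefLaw C l := by
          rw [lintegral_add_left (hmk.const_mul _), lintegral_const_mul _ hmk,
            lintegral_moveKernel_update a o l hΦ]
      _ ≤ ENNReal.ofReal (2 * p) * ∫⁻ b, Φ b ∂G.beliefLaw C ((a, o) :: l) +
            ENNReal.ofReal p * ENNReal.ofReal (Real.exp (-(C * K))) :=
          add_le_add le_rfl (hex.trans e1)
      _ = _ := by
          rw [ENNReal.ofReal_mul zero_le_two, ENNReal.ofReal_ofNat]; ring

end POSG

namespace POSG

variable {N : Type uN} [Fintype N] [DecidableEq N] {S : Type uS} [MeasurableSpace S]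
  {A : N → Type uA} {O : N → Type uO}
  [∀ i, Fintype (A i)] [∀ i, Fintype (O i)] (G : POSG N S A O)

/-! ### The error of the estimates on the random tree -/

/-- The joint action of a joint pure policy at a joint history. -/
def jointAct (σ : ∀ i, G.Pure i) (l : G.JointHist) {n : ℕ} (hl : l.length + n = G.D) :
    ∀ i, A i := fun i => σ i (G.info i l hl)

theorem sum_actProb_toBehav_mul (σ : ∀ i, G.Pure i) (l : G.JointHist) {n : ℕ}
    (hl : l.length + n = G.D) (f : (∀ i, A i) → ℝ) :
    ∑ a, G.actProb (fun j => (σ j).toBehav) l hl a * f a = f (G.jointAct σ l hl) := by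
  classical
  rw [Finset.sum_eq_single (G.jointAct σ l hl)]
  · have : G.actProb (fun j => (σ j).toBehav) l hl (G.jointAct σ l hl) = 1 :=
      Finset.prod_eq_one fun i _ => by simp [Pure.toBehav, pointMass, jointAct]
    rw [this, one_mul]
  · intro a _ ha
    obtain ⟨i, hi⟩ := Function.ne_iff.1 ha
    have : G.actProb (fun j => (σ j).toBehav) l hl a = 0 :=
      Finset.prod_eq_zero (Finset.mem_univ i) (by
        simp only [Pure.toBehav, pointMass]
        rw [Pi.single_apply]
        exact if_neg hi)
    rw [this, zero_mul]
  · simp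

theorem integral_weight_mul_value_toBehav_zero (σ : ∀ i, G.Pure i) (i : N) (l : G.JointHist)
    (hl : l.length + 0 = G.D) :
    ∫ x, (x.2 : ℝ) * G.r i x.1 (G.jointAct σ l hl) ∂G.weightLaw l =
      G.likelihood l * G.histValue (fun j => (σ j).toBehav) i 0 l hl := by
  rw [likelihood_mul_histValue]
  simp only [value, sum_actProb_toBehav_mul]

theorem integral_weight_mul_lookahead_toBehav {i : N} {R : ℝ} (hR : ∀ s a, |G.r i s a| ≤ R)
    (σ : ∀ i, G.Pure i) (n : ℕ) (l : G.JointHist) (hl : l.length + (n + 1) = G.D) :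
    ∫ x, (x.2 : ℝ) * G.lookahead (fun j => (σ j).toBehav) i n l hl (G.jointAct σ l hl) x.1
        ∂G.weightLaw l =
      G.likelihood l * G.histValue (fun j => (σ j).toBehav) i (n + 1) l hl := by
  rw [likelihood_mul_histValue, G.integral_weight_mul_lookahead hR]
  simp only [value, sum_actProb_toBehav_mul]

theorem lintegral_childKernel (C : ℕ) [NeZero C] (a : ∀ i, A i) (b : G.Belief C)
    {g : JointObs O × G.Belief C → ℝ≥0∞} (hg : Measurable g) :
    ∫⁻ q, g q ∂G.childKernel C a b =
      ∑ o, G.obsProb b a o * ∫⁻ s', g (o, G.update a b o s') ∂G.moveKernel C a b := by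
  have hgu : Measurable fun p : G.Belief C × (JointObs O × (Fin C → S)) =>
      g (p.2.1, G.update a p.1 p.2.1 p.2.2) := hg.comp (G.measurable_update (C := C) a)
  unfold childKernel
  rw [Kernel.lintegral_map _ (G.measurable_update a) _ hg, Kernel.lintegral_id_prod hgu,
    Kernel.prod_apply]
  have hgb : Measurable fun p : JointObs O × (Fin C → S) => g (p.1, G.update a b p.1 p.2) :=
    hgu.comp measurable_prodMk_left
  rw [lintegral_prod _ hgb.aemeasurable]
  change ∫⁻ o, _ ∂(∑ o, G.obsProb b a o • Measure.dirac o : Measure (JointObs O)) = _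
  rw [lintegral_finsetSum_measure]
  refine Finset.sum_congr rfl fun o _ => ?_
  rw [lintegral_smul_measure, lintegral_dirac]
  rfl

/-- The law of one child of a node together with what is below the child. -/
noncomputable def subtreeLaw (C : ℕ) [NeZero C] (n : ℕ) (a : ∀ i, A i) (b : G.Belief C) :
    Measure ((JointObs O × G.Belief C) × G.Tree C n) :=
  (G.childKernel C a ⊗ₖ (G.treeLaw C n).1.comap
    (fun p : G.Belief C × (JointObs O × G.Belief C) => p.2.2) (by fun_prop)) b

instance (C : ℕ) [NeZero C] (n : ℕ) (a : ∀ i, A i) (b : G.Belief C) :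
    IsProbabilityMeasure (G.subtreeLaw C n a b) := by
  have := (G.treeLaw C n).2
  unfold subtreeLaw; infer_instance

theorem subtreeLaw_apply (C : ℕ) [NeZero C] (n : ℕ) (a : ∀ i, A i) (b : G.Belief C)
    {s : Set ((JointObs O × G.Belief C) × G.Tree C n)} (hs : MeasurableSet s) :
    G.subtreeLaw C n a b s = ∑ o, G.obsProb b a o * ∫⁻ s',
      (G.treeLaw C n).1 (G.update a b o s') {τ | ((o, G.update a b o s'), τ) ∈ s}
        ∂G.moveKernel C a b := by
  have := (G.treeLaw C n).2
  unfold subtreeLaw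
  rw [Kernel.compProd_apply hs]
  have hm : Measurable fun q : JointObs O × G.Belief C =>
      ((G.treeLaw C n).1.comap Prod.snd measurable_snd) q (Prod.mk q ⁻¹' s) :=
    Kernel.measurable_kernel_prodMk_left hs
  exact G.lintegral_childKernel C a b hm

theorem subtreeLaw_obs_eq (C : ℕ) [NeZero C] (n : ℕ) (a : ∀ i, A i) (b : G.Belief C)
    (o : JointObs O) : G.subtreeLaw C n a b {q | q.1.1 = o} = G.obsProb b a o := by
  have hs : MeasurableSet {q : (JointObs O × G.Belief C) × G.Tree C n | q.1.1 = o} :=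
    measurable_fst.fst (measurableSet_singleton o)
  have := (G.treeLaw C n).2
  rw [G.subtreeLaw_apply C n a b hs, Finset.sum_eq_single o]
  · simp
  · intro o' _ ho
    simp [ho]
  · simp

theorem integral_subtreeLaw_obs (C : ℕ) [NeZero C] (n : ℕ) (a : ∀ i, A i) (b : G.Belief C)
    (v : JointObs O → ℝ) :
    ∫ q, v q.1.1 ∂G.subtreeLaw C n a b = ∑ o, (G.obsProb b a o).toReal * v o := by
  have hm : Measurable fun q : (JointObs O × G.Belief C) × G.Tree C n => q.1.1 :=
    measurable_fst.fst
  have : IsProbabilityMeasure ((G.subtreeLaw C n a b).map fun q => q.1.1) :=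
    Measure.isProbabilityMeasure_map hm.aemeasurable
  rw [← integral_map (φ := fun q : (JointObs O × G.Belief C) × G.Tree C n => q.1.1)
    hm.aemeasurable (measurable_of_finite v).aestronglyMeasurable,
    integral_fintype (Integrable.of_finite)]
  refine Finset.sum_congr rfl fun o _ => ?_
  rw [smul_eq_mul, measureReal_def, Measure.map_apply hm (measurableSet_singleton o)]
  congr 2
  exact G.subtreeLaw_obs_eq C n a b o

/-- The allowed error of an estimate when `n` steps remain. -/
noncomputable def errBound (lam : ℝ) (n : ℕ) : ℝ := lam * (2 * G.partialGeom n - 1)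

/-- The three terms are the errors of the weighted particle estimate, of the average over `C`
sampled observations, and of the estimates at the children. -/
theorem errBound_succ (lam : ℝ) (n : ℕ) :
    G.errBound lam (n + 1) = lam + G.γ * lam + G.γ * G.errBound lam n := by
  unfold errBound; rw [partialGeom_succ]; ring

/-- The probability that the estimate at a node with belief `b` has a large error. -/
noncomputable def failProb (C : ℕ) [NeZero C] (lam : ℝ) (π : ∀ i, G.Behav i) (i : N) (n : ℕ)
    (l : G.JointHist) (hl : l.length + n = G.D) (b : G.Belief C) : ℝ≥0∞ :=
  (G.treeLaw C n).1 b
    {τ | G.errBound lam n < |G.valueEst π i n l hl b τ - G.histValue π i n l hl|}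

theorem measurableSet_fail (C : ℕ) (lam : ℝ) (π : ∀ i, G.Behav i) (i : N) (n : ℕ)
    (l : G.JointHist) (hl : l.length + n = G.D) :
    MeasurableSet {p : G.Belief C × G.Tree C n |
      G.errBound lam n < |G.valueEst π i n l hl p.1 p.2 - G.histValue π i n l hl|} :=
  measurableSet_lt measurable_const ((G.measurable_valueEst π n l hl).sub_const _).abs

theorem measurable_failProb (C : ℕ) [NeZero C] (lam : ℝ) (π : ∀ i, G.Behav i) (i : N) (n : ℕ)
    (l : G.JointHist) (hl : l.length + n = G.D) :
    Measurable (G.failProb C lam π i n l hl) :=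
  have := (G.treeLaw C n).2
  Kernel.measurable_kernel_prodMk_left (G.measurableSet_fail C lam π i n l hl)

theorem failProb_le_one (C : ℕ) [NeZero C] (lam : ℝ) (π : ∀ i, G.Behav i) (i : N) (n : ℕ)
    (l : G.JointHist) (hl : l.length + n = G.D) (b : G.Belief C) :
    G.failProb C lam π i n l hl b ≤ 1 :=
  have := (G.treeLaw C n).2
  prob_le_one

variable {G} {C : ℕ} [NeZero C] {lam K R : ℝ} {i : N}

/-- Under a pure profile only the `C` children of one action count, and these are independent
copies. Hoeffding's inequality for their true values gives the first term, the union bound over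
failures at the children the second. -/
theorem failProb_succ_le (hR : ∀ s a, |G.r i s a| ≤ R) (hR0 : 0 ≤ R)
    (hK : TailBounds C G.dInfMax (R * G.partialGeom G.D) lam K) (σ : ∀ i, G.Pure i) (n : ℕ)
    (l : G.JointHist) (hl : l.length + (n + 1) = G.D) (b : G.Belief C)
    (hb : |∑ j, (G.normWeight b j : ℝ) *
        G.lookahead (fun j => (σ j).toBehav) i n l hl (G.jointAct σ l hl) (b j).1 -
      G.histValue (fun j => (σ j).toBehav) i (n + 1) l hl| ≤ lam) :
    G.failProb C lam (fun j => (σ j).toBehav) i (n + 1) l hl b ≤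
      2 * ENNReal.ofReal (Real.exp (-(C * K))) + C * ∑ o, G.obsProb b (G.jointAct σ l hl) o *
        ∫⁻ s', G.failProb C lam (fun j => (σ j).toBehav) i n ((G.jointAct σ l hl, o) :: l)
          (by rw [List.length_cons]; omega) (G.update (G.jointAct σ l hl) b o s')
          ∂G.moveKernel C (G.jointAct σ l hl) b := by
  set a := G.jointAct σ l hl with ha
  set π : ∀ i, G.Behav i := fun j => (σ j).toBehav with hπ
  have hlen : ∀ o : JointObs O, ((a, o) :: l).length + n = G.D := fun o => by
    rw [List.length_cons]; omega
  have hC : (0 : ℝ) < C := by exact_mod_cast NeZero.pos C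
  set v : JointObs O → ℝ := fun o => G.histValue π i n ((a, o) :: l) (hlen o) with hv
  set m : ℝ := ∑ o, (G.obsProb b a o).toReal * v o with hm
  set M := R * G.partialGeom G.D with hMdef
  have hvM : ∀ o, |v o| ≤ M := fun o => (G.abs_histValue_le hR hR0 π n _ _).trans
    (mul_le_mul_of_nonneg_left (G.partialGeom_mono (by omega)) hR0)
  let B : Set ((JointObs O × G.Belief C) × G.Tree C n) := {q | G.errBound lam n <
    |G.valueEst π i n ((a, q.1.1) :: l) (hlen q.1.1) q.1.2 q.2 - v q.1.1|}
  have hBm : MeasurableSet B := by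
    have h1 : Measurable fun q : JointObs O × (G.Belief C × G.Tree C n) =>
        G.valueEst π i n ((a, q.1) :: l) (hlen q.1) q.2.1 q.2.2 :=
      measurable_from_prod_countable_right fun o =>
        G.measurable_valueEst (i := i) π n ((a, o) :: l) (hlen o)
    have h2 : Measurable fun q : (JointObs O × G.Belief C) × G.Tree C n =>
        G.valueEst π i n ((a, q.1.1) :: l) (hlen q.1.1) q.1.2 q.2 :=
      h1.comp (by fun_prop : Measurable fun q : (JointObs O × G.Belief C) × G.Tree C n =>
        (q.1.1, (q.1.2, q.2)))
    exact measurableSet_lt measurable_const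
      (h2.sub ((measurable_of_finite v).comp measurable_fst.fst)).abs
  have hB : G.subtreeLaw C n a b B = ∑ o, G.obsProb b a o *
      ∫⁻ s', G.failProb C lam π i n ((a, o) :: l) (hlen o) (G.update a b o s')
        ∂G.moveKernel C a b := G.subtreeLaw_apply C n a b hBm
  rw [← hB]
  let μ : (∀ i, A i) × Fin C → Measure ((JointObs O × G.Belief C) × G.Tree C n) :=
    fun x => G.subtreeLaw C n x.1 b
  -- Applied to the true values `v` of the children, which depend on the sampled observation only,
  -- so that their mean is the exact one-step value `m`.
  have hHoeff := measure_pi_abs_sum_ge_le (μ := μ) (e := fun k : Fin C => (a, k))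
    (fun k k' h => (Prod.ext_iff.1 h).2) (ν := G.subtreeLaw C n a b) (fun _ => rfl) (g := fun q => v q.1.1)
    ((measurable_of_finite v).comp measurable_fst.fst) (lo := -M) (B := 2 * M)
    (by linarith [hK.M_pos]) (Filter.Eventually.of_forall fun q => by
      have := abs_le.1 (hvM q.1.1)
      constructor <;> linarith) hK.lam_pos.le
  rw [G.integral_subtreeLaw_obs C n a b v, Fintype.card_fin, ← hm] at hHoeff
  have hexp : ENNReal.ofReal (Real.exp (-(2 * C * lam ^ 2 / (2 * M) ^ 2))) ≤
      ENNReal.ofReal (Real.exp (-(C * K))) := by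
    refine ofReal_exp_neg_le ?_
    have hMp := hK.M_pos
    have h2 : 2 * C * lam ^ 2 / (2 * M) ^ 2 = C * (lam ^ 2 / (2 * M ^ 2)) := by
      field_simp
    rw [h2]
    exact mul_le_mul_of_nonneg_left hK.le_sample hC.le
  have hchild : ∀ k : Fin C, Measure.pi μ {τ | τ (a, k) ∈ B} = G.subtreeLaw C n a b B :=
    fun k => (measurePreserving_eval μ (a, k)).measure_preimage hBm.nullMeasurableSet
  have hsub : {τ : (∀ i, A i) × Fin C → (JointObs O × G.Belief C) × G.Tree C n |
        G.errBound lam (n + 1) <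
          |G.valueEst π i (n + 1) l hl b τ - G.histValue π i (n + 1) l hl|} ⊆
      {τ | C * lam ≤ |∑ k, (v (τ (a, k)).1.1 - m)|} ∪ ⋃ k, {τ | τ (a, k) ∈ B} := by
    intro τ hτ
    by_contra hcon
    simp only [Set.mem_union, Set.mem_iUnion, Set.mem_ofPred_eq, not_or, not_exists, not_le, B,
      not_lt] at hcon
    obtain ⟨h1, h2⟩ := hcon
    refine absurd hτ ?_
    simp only [Set.mem_ofPred_eq, not_lt]
    rw [errBound_succ]
    simp only [valueEst]
    rw [hπ, sum_actProb_toBehav_mul, ← ha, ← hπ]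
    have h3 : |∑ k, (G.valueEst π i n ((a, (τ (a, k)).1.1) :: l) (hlen _) (τ (a, k)).1.2
        (τ (a, k)).2 - v (τ (a, k)).1.1)| ≤ C * G.errBound lam n := by
      refine (Finset.abs_sum_le_sum_abs _ _).trans ((Finset.sum_le_sum fun k _ => h2 k).trans_eq ?_)
      simp
    rw [← G.rewardEst_add_eq_sum_lookahead π i n l hl a b] at hb
    change |G.rewardEst i b a + G.γ * m - _| ≤ _ at hb
    rw [Finset.sum_sub_distrib] at h1 h3
    simp only [Finset.sum_const, Finset.card_univ, Fintype.card_fin, nsmul_eq_mul] at h1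
    set x := ∑ k, v (τ (a, k)).1.1
    set y := ∑ k, G.valueEst π i n ((a, (τ (a, k)).1.1) :: l) (hlen _) (τ (a, k)).1.2
        (τ (a, k)).2
    set V := G.histValue π i (n + 1) l hl
    -- The particle error, the sampling error and the children's errors, in the order of
    -- `errBound_succ`.
    have e : G.rewardEst i b a + G.γ / C * y - V = (G.rewardEst i b a + G.γ * m - V) +
        (G.γ / C * (x - C * m) + G.γ / C * (y - x)) := by field_simp; ring
    have hγC : 0 ≤ G.γ / C := div_nonneg G.γ_nonneg hC.le
    have e1 : |G.γ / C * (x - C * m)| ≤ G.γ * lam := by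
      rw [abs_mul, abs_of_nonneg hγC]
      refine (mul_le_mul_of_nonneg_left h1.le hγC).trans_eq ?_
      field_simp
    have e2 : |G.γ / C * (y - x)| ≤ G.γ * G.errBound lam n := by
      rw [abs_mul, abs_of_nonneg hγC]
      refine (mul_le_mul_of_nonneg_left h3 hγC).trans_eq ?_
      field_simp
    change |G.rewardEst i b a + G.γ / C * y - V| ≤ _
    rw [e]
    refine (abs_add_le _ _).trans ?_
    have := abs_add_le (G.γ / C * (x - C * m)) (G.γ / C * (y - x))
    linarith
  have hunion : Measure.pi μ ({τ | C * lam ≤ |∑ k, (v (τ (a, k)).1.1 - m)|} ∪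
      ⋃ k, {τ | τ (a, k) ∈ B}) ≤
      2 * ENNReal.ofReal (Real.exp (-(C * K))) + C * G.subtreeLaw C n a b B := by
    refine (measure_union_le _ _).trans (add_le_add (hHoeff.trans (by gcongr)) ?_)
    refine (measure_iUnion_le _).trans_eq ?_
    rw [tsum_fintype]
    simp only [hchild, Finset.sum_const, Finset.card_univ, Fintype.card_fin, nsmul_eq_mul]
  exact le_trans (measure_mono (μ := Measure.pi μ) hsub) hunion

theorem lintegral_le_measure_not_add {α : Type*} [MeasurableSpace α] {μ : Measure α}
    {f g : α → ℝ≥0∞} (hg : Measurable g) {p : α → Prop} (hf : ∀ x, f x ≤ 1)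
    (h : ∀ x, p x → f x ≤ g x) : ∫⁻ x, f x ∂μ ≤ μ {x | ¬ p x} + ∫⁻ x, g x ∂μ := by
  calc _ ≤ ∫⁻ x, ({x | ¬ p x}.indicator 1 x + g x) ∂μ := by
        refine lintegral_mono fun x => ?_
        by_cases hx : p x
        · exact (h x hx).trans le_add_self
        · refine (hf x).trans ?_
          rw [Set.indicator_of_mem (by exact hx)]
          exact le_self_add
    _ ≤ _ := by
        rw [lintegral_add_right _ hg]
        exact add_le_add (lintegral_indicator_one_le _) le_rfl

/-- If `c` is the constant for the children, a node costs 3 for a belief that is not good, 2 for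
sampling observations and `C * (4 * c + 2)` for the children. In the last term one factor 2 comes
from the normalization and the other from the bound `2 * p_o`. -/
theorem lintegral_failProb_le (hR : ∀ s a, |G.r i s a| ≤ R) (hR0 : 0 ≤ R)
    (hK : TailBounds C G.dInfMax (R * G.partialGeom G.D) lam K) (σ : ∀ i, G.Pure i) (n : ℕ) :
    ∀ (l : G.JointHist) (hl : l.length + n = G.D), 0 < G.likelihood l →
      ∫⁻ b, G.failProb C lam (fun j => (σ j).toBehav) i n l hl b ∂G.beliefLaw C l ≤
        ENNReal.ofReal (5 * (4 * C) ^ (n + 1) - 4) * ENNReal.ofReal (Real.exp (-(C * K))) := by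
  have hC1 : (1 : ℝ) ≤ C := by exact_mod_cast NeZero.one_le
  set e := ENNReal.ofReal (Real.exp (-(C * K))) with he
  set π : ∀ i, G.Behav i := fun j => (σ j).toBehav with hπ
  have hbound : ∀ (n : ℕ) (l : G.JointHist) (hl : l.length + n = G.D),
      |G.histValue π i n l hl| ≤ R * G.partialGeom G.D := fun n l hl =>
    (G.abs_histValue_le hR hR0 π n l hl).trans
      (mul_le_mul_of_nonneg_left (G.partialGeom_mono (by omega)) hR0)
  induction n with
  | zero =>
    intro l hl hp
    have hbad := beliefLaw_not_good_le hK (by omega) hp (G.r_measurable i (G.jointAct σ l hl))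
      (fun s => (hR s _).trans (le_mul_of_one_le_right hR0 (G.one_le_partialGeom _)))
      (hbound 0 l hl) (G.integral_weight_mul_value_toBehav_zero σ i l hl)
    have := lintegral_le_measure_not_add (μ := G.beliefLaw C l)
      (f := G.failProb C lam π i 0 l hl) (g := fun _ => 0) measurable_const
      (G.failProb_le_one C lam π i 0 l hl) (fun b hb => ?_)
        (p := G.GoodBelief (G.likelihood l) lam (fun s => G.r i s (G.jointAct σ l hl))
          (G.histValue π i 0 l hl))
    · refine this.trans ?_
      rw [lintegral_zero, add_zero]
      refine hbad.trans (mul_le_mul_left ?_ _)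
      rw [← ENNReal.ofReal_ofNat]
      exact ENNReal.ofReal_le_ofReal (by rw [zero_add, pow_one]; linarith)
    · have h1 := hb.abs_estimate_sub_le hp.le hK.lam_pos.le
      rw [nonpos_iff_eq_zero]
      unfold failProb
      convert measure_empty (μ := (G.treeLaw C 0).1 b)
      ext τ
      simp only [Set.mem_ofPred_eq, Set.mem_empty_iff_false, iff_false, not_lt]
      simp only [valueEst]
      rw [hπ, sum_actProb_toBehav_mul, ← hπ]
      have h2 : G.errBound lam 0 = lam := by simp [errBound, partialGeom]; ring
      rw [h2]
      exact h1
  | succ n ih =>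
    intro l hl hp
    have hlen : ∀ o : JointObs O, ((G.jointAct σ l hl, o) :: l).length + n = G.D := fun o => by
      rw [List.length_cons]; omega
    set a := G.jointAct σ l hl with ha
    set p := G.likelihood l with hpdef
    set Φ : JointObs O → G.Belief C → ℝ≥0∞ := fun o =>
      G.failProb C lam π i n ((a, o) :: l) (hlen o)
    have hΦ : ∀ o, Measurable (Φ o) := fun o => G.measurable_failProb C lam π i n _ _
    set w : JointObs O → G.Belief C → ℝ≥0∞ := fun o b =>
      ENNReal.ofReal ((∑ j, ((b j).2 : ℝ) * G.obsLik a o (b j).1) / C) *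
        ∫⁻ s', Φ o (G.update a b o s') ∂G.moveKernel C a b with hw
    have hwm : ∀ o, Measurable (w o) := fun o => by
      refine Measurable.mul ?_ (((hΦ o).comp
        (measurable_update_left a o)).lintegral_kernel_prod_right' (κ := G.moveKernel C a))
      refine (Measurable.div_const (Finset.measurable_sum _ fun j _ => ?_) _).ennreal_ofReal
      exact (by fun_prop : Measurable fun b : G.Belief C => ((b j).2 : ℝ)).mul
        ((G.measurable_obsLik a o).comp (by fun_prop : Measurable fun b : G.Belief C => (b j).1))
    have hbad := beliefLaw_not_good_le hK (by omega) hp (G.measurable_lookahead π i n l hl a)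
      (fun s => (G.abs_lookahead_le hR hR0 π n l hl a s).trans
        (mul_le_mul_of_nonneg_left (G.partialGeom_mono (by omega)) hR0))
      (hbound (n + 1) l hl) (G.integral_weight_mul_lookahead_toBehav hR σ n l hl)
    have hgm : Measurable fun b => 2 * e + C * ∑ o, ENNReal.ofReal (2 / p) * w o b :=
      ((Finset.measurable_sum _ fun o _ => (hwm o).const_mul _).const_mul _).const_add _
    have hmain := lintegral_le_measure_not_add (μ := G.beliefLaw C l)
      (f := G.failProb C lam π i (n + 1) l hl) hgm
      (G.failProb_le_one C lam π i (n + 1) l hl) (fun b hb => ?_)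
        (p := G.GoodBelief p lam (G.lookahead π i n l hl a) (G.histValue π i (n + 1) l hl))
    · refine hmain.trans ((add_le_add hbad le_rfl).trans ?_)
      set c : ℝ := 5 * (4 * C) ^ (n + 1) - 4 with hc
      have hc0 : 0 ≤ c := by
        have : (1 : ℝ) ≤ (4 * C) ^ (n + 1) := one_le_pow₀ (by linarith)
        rw [hc]; linarith
      have hobs : ∀ o, ∫⁻ b, w o b ∂G.beliefLaw C l ≤
          ENNReal.ofReal (G.likelihood ((a, o) :: l)) * (ENNReal.ofReal (2 * c + 1) * e) := by
        intro o
        refine (lintegral_obs_mul_le hK (by omega) a o (hΦ o)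
          (G.failProb_le_one C lam π i n _ _)).trans ?_
        -- The induction hypothesis covers positive likelihood only; otherwise the previous bound is
        -- already zero.
        rcases (G.likelihood_nonneg ((a, o) :: l)).eq_or_lt with h0 | h0
        · rw [← h0]; simp
        · refine mul_le_mul_right ?_ _
          rw [ENNReal.ofReal_add (by positivity) zero_le_one, ENNReal.ofReal_mul zero_le_two,
            add_mul, ENNReal.ofReal_one, one_mul, ENNReal.ofReal_ofNat, mul_assoc]
          exact add_le_add (mul_le_mul_right (ih _ (hlen o) h0) _) le_rfl
      have hlik : ∑ o, ENNReal.ofReal (G.likelihood ((a, o) :: l)) = ENNReal.ofReal p := by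
        rw [← ENNReal.ofReal_sum_of_nonneg fun o _ => G.likelihood_nonneg _,
          G.sum_likelihood_cons]
      have hsum : ∫⁻ b, (2 * e + C * ∑ o, ENNReal.ofReal (2 / p) * w o b) ∂G.beliefLaw C l ≤
          2 * e + C * (ENNReal.ofReal (2 / p) *
            (ENNReal.ofReal p * (ENNReal.ofReal (2 * c + 1) * e))) := by
        rw [lintegral_add_left measurable_const, lintegral_const, measure_univ, mul_one,
          lintegral_const_mul _ (Finset.measurable_sum _ fun o _ => (hwm o).const_mul _),
          lintegral_finsetSum _ fun o _ => (hwm o).const_mul _]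
        simp_rw [lintegral_const_mul _ (hwm _)]
        rw [← Finset.mul_sum, ← hlik, Finset.sum_mul]
        gcongr with o
        exact hobs o
      refine (add_le_add le_rfl hsum).trans ?_
      have hCe : (C : ℝ≥0∞) = ENNReal.ofReal C := (ENNReal.ofReal_natCast C).symm
      have h3 : (3 : ℝ≥0∞) = ENNReal.ofReal 3 := (ENNReal.ofReal_ofNat 3).symm
      have h2 : (2 : ℝ≥0∞) = ENNReal.ofReal 2 := (ENNReal.ofReal_ofNat 2).symm
      rw [he, hCe, h3, h2]
      have hx : 0 ≤ Real.exp (-(C * K)) := (Real.exp_pos _).le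
      rw [← ENNReal.ofReal_mul (by positivity), ← ENNReal.ofReal_mul (by positivity),
        ← ENNReal.ofReal_mul (by positivity), ← ENNReal.ofReal_mul hp.le,
        ← ENNReal.ofReal_mul (by positivity), ← ENNReal.ofReal_mul (by positivity),
        ← ENNReal.ofReal_add (by positivity) (by positivity),
        ← ENNReal.ofReal_add (by positivity) (by positivity),
        ← ENNReal.ofReal_mul (by
          have : (1 : ℝ) ≤ (4 * C) ^ (n + 1 + 1) := one_le_pow₀ (by linarith)
          linarith)]
      refine ENNReal.ofReal_le_ofReal ?_
      have e1 : 2 / p * (p * ((2 * c + 1) * Real.exp (-(C * K)))) =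
          (4 * c + 2) * Real.exp (-(C * K)) := by field_simp; ring
      rw [e1]
      have e2 : 3 * Real.exp (-(C * K)) + (2 * Real.exp (-(C * K)) +
          C * ((4 * c + 2) * Real.exp (-(C * K)))) =
          (5 + C * (4 * c + 2)) * Real.exp (-(C * K)) := by ring
      rw [e2]
      refine mul_le_mul_of_nonneg_right ?_ hx
      -- Here `5 + C * (4 * c + 2) = 5 * (4 * C) ^ (n + 2) + 5 - 14 * C`, and `14 * C ≥ 9`. The `-4`
      -- in the claim absorbs the additive costs.
      rw [pow_succ, hc]
      nlinarith
    · refine (failProb_succ_le hR hR0 hK σ n l hl b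
        (hb.abs_estimate_sub_le hp.le hK.lam_pos.le)).trans ?_
      refine add_le_add le_rfl (mul_le_mul_right (Finset.sum_le_sum fun o _ => ?_) _)
      rw [hw, ← mul_assoc]
      exact mul_le_mul_left (hb.obsProb_le (NeZero.pos C) hp a o) _

end POSG

namespace POSG

variable {N : Type uN} [Fintype N] [DecidableEq N] {S : Type uS} [MeasurableSpace S]
  {A : N → Type uA} {O : N → Type uO}
  [∀ i, Fintype (A i)] [∀ i, Fintype (O i)] (G : POSG N S A O)

/-! ### The probability of a large error of an estimated utility -/

theorem map_pi_initial (C : ℕ) :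
    ((Measure.pi fun _ : Fin C => G.b₀).map fun s j => ((s j, 1) : S × ℝ≥0)) =
      G.beliefLaw C [] :=
  have : IsProbabilityMeasure (G.b₀.map fun s => ((s, 1) : S × ℝ≥0)) :=
    Measure.isProbabilityMeasure_map (by fun_prop : Measurable _).aemeasurable
  Measure.pi_map_pi (μ := fun _ : Fin C => G.b₀) (f := fun _ s => ((s, 1) : S × ℝ≥0))
    fun _ => (by fun_prop : Measurable _).aemeasurable

theorem cditLaw_fail_eq (C : ℕ) [NeZero C] (lam : ℝ) (π : ∀ i, G.Behav i) (i : N) :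
    G.cditLaw C {τ | G.eps lam < |G.utilityEst τ i π - G.utility i π|} =
      ∫⁻ b, G.failProb C lam π i G.D [] (by simp) b ∂G.beliefLaw C [] := by
  have := (G.treeLaw C G.D).2
  rw [← histValue_nil]
  unfold cditLaw
  rw [map_pi_initial]
  exact Measure.compProd_apply (G.measurableSet_fail C lam π i G.D [] (by simp))

variable {G} in
-- For `lam < 2 * vMax` the bound `κ ≤ lam / (4 * M * d)` is below `1 / (2 * d)`, which serves the
-- total weight, and positivity of `kMax` forces `√C > 2 * d`. All inequalities of `TailBounds` then
-- hold with room to spare.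
theorem tailBounds_kAcute {C : ℕ} [NeZero C] {lam R : ℝ} (hR0 : 0 ≤ R)
    (hk : 0 < G.kMax lam C R) (hlam : lam < 2 * G.vMax R) :
    TailBounds C G.dInfMax (G.vMax R) lam (G.kAcute lam C R ^ 2) := by
  have hC : (0 : ℝ) < C := by exact_mod_cast NeZero.pos C
  have hd0 : 0 ≤ G.dInfMax := ENNReal.toReal_nonneg
  have hM0 : 0 ≤ G.vMax R :=
    mul_nonneg hR0 (zero_le_one.trans (G.one_le_partialGeom G.D))
  have hsq : 0 < √(C : ℝ) := Real.sqrt_pos.2 hC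
  unfold kAcute
  have hk' := hk
  unfold kMax at hk'
  have hfrac : 1 / √(C : ℝ) < lam / (4 * G.vMax R * G.dInfMax) := by linarith
  have hpos : 0 < lam / (4 * G.vMax R * G.dInfMax) := (by positivity : 0 < 1 / √(C : ℝ)).trans hfrac
  -- A quotient with denominator zero is zero, so a positive one excludes `d = 0` and `M = 0`.
  have hd : 0 < G.dInfMax := hd0.lt_of_ne fun h => by rw [← h] at hpos; simp at hpos
  have hM : 0 < G.vMax R := hM0.lt_of_ne fun h => by rw [← h] at hpos; simp at hpos
  have hl : 0 < lam := by
    by_contra h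
    exact absurd (div_nonpos_of_nonpos_of_nonneg (not_lt.1 h)
      (by positivity : 0 ≤ 4 * G.vMax R * G.dInfMax)) (not_le.2 hpos)
  set M := G.vMax R
  set d := G.dInfMax
  set κ := min (G.kMax lam C R) (lam / (4 * √2 * M)) with hκ
  have hκ0 : 0 < κ := lt_min hk (by positivity)
  have hκ1 : κ ≤ lam / (4 * M * d) := (min_le_left _ _).trans (by
    have : 0 < 1 / √(C : ℝ) := by positivity
    unfold kMax; linarith)
  have hκ2 : κ ≤ lam / (4 * √2 * M) := min_le_right _ _
  have s1 : κ ^ 2 ≤ (lam / (4 * M * d)) ^ 2 := pow_le_pow_left₀ hκ0.le hκ1 2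
  have s2 : κ ^ 2 ≤ (lam / (4 * √2 * M)) ^ 2 := pow_le_pow_left₀ hκ0.le hκ2 2
  refine ⟨hd, hM, hl, ?_, s1.trans ?_, s1.trans ?_, s2.trans ?_⟩
  · have h1 : lam / (4 * M * d) < 1 / (2 * d) := by
      rw [div_lt_div_iff₀ (by positivity) (by positivity)]
      nlinarith
    have h2 := hfrac.trans h1
    rw [div_lt_div_iff₀ hsq (by positivity), one_mul, one_mul] at h2
    have h3 : (√(C : ℝ)) ^ 2 = C := Real.sq_sqrt hC.le
    nlinarith
  · rw [div_pow, div_le_div_iff₀ (by positivity) (by positivity)]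
    have : lam ^ 2 ≤ (2 * M) ^ 2 := pow_le_pow_left₀ hl.le hlam.le 2
    nlinarith [mul_le_mul_of_nonneg_right this (sq_nonneg d), sq_nonneg (M * d)]
  · rw [div_pow]
    gcongr
    nlinarith [sq_nonneg (M * d)]
  · have h2 : (√2 : ℝ) ^ 2 = 2 := Real.sq_sqrt zero_le_two
    rw [div_pow]
    gcongr
    rw [mul_pow, mul_pow, h2]
    nlinarith [sq_nonneg M]

/-- For `lam ≥ 2 * vMax` failure is impossible, as both utilities are bounded by `vMax` and `eps` is
at least `lam`. This leaves the range of `lam` in which the tail bounds apply. -/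
theorem cditLaw_fail_le {C : ℕ} [NeZero C] {lam R : ℝ} {i : N} (hR : ∀ s a, |G.r i s a| ≤ R)
    (hR0 : 0 ≤ R) (hk : 0 < G.kMax lam C R) (σ : ∀ i, G.Pure i) :
    G.cditLaw C {τ | G.eps lam < |G.utilityEst τ i (fun j => (σ j).toBehav) -
        G.utility i fun j => (σ j).toBehav|} ≤
      ENNReal.ofReal (5 * (4 * C) ^ (G.D + 1) * Real.exp (-C * G.kAcute lam C R ^ 2)) := by
  have hC1 : (1 : ℝ) ≤ C := by exact_mod_cast NeZero.one_le
  rcases lt_or_ge lam (2 * G.vMax R) with h | h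
  · have hK := tailBounds_kAcute hR0 hk h
    rw [cditLaw_fail_eq]
    refine (lintegral_failProb_le hR hR0 hK σ G.D [] (by simp)
      (by rw [likelihood_nil]; exact one_pos)).trans ?_
    have h1 : (1 : ℝ) ≤ (4 * C) ^ (G.D + 1) := one_le_pow₀ (by linarith)
    rw [← ENNReal.ofReal_mul (by linarith), ← neg_mul]
    refine ENNReal.ofReal_le_ofReal (mul_le_mul_of_nonneg_right (by linarith) (Real.exp_pos _).le)
  · have : {τ : G.CDIT C | G.eps lam < |G.utilityEst τ i (fun j => (σ j).toBehav) -
        G.utility i fun j => (σ j).toBehav|} = ∅ := by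
      ext τ
      simp only [Set.mem_ofPred_eq, Set.mem_empty_iff_false, iff_false, not_lt]
      have h1 := G.abs_utilityEst_le hR (NeZero.pos C) τ fun j => (σ j).toBehav
      have h2 := G.abs_utility_le hR fun j => (σ j).toBehav
      have h3 := (abs_sub (G.utilityEst τ i (fun j => (σ j).toBehav))
        (G.utility i fun j => (σ j).toBehav)).trans (add_le_add h1 h2)
      have hg := G.one_le_partialGeom G.D
      have hlam : 0 ≤ lam := le_trans (by
        change 0 ≤ 2 * (R * G.partialGeom G.D); positivity) h
      change 2 * (R * G.partialGeom G.D) ≤ lam at h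
      change _ ≤ lam * (2 * G.partialGeom G.D - 1)
      nlinarith
    rw [this, measure_empty]
    exact zero_le

theorem measurable_utilityEst {C : ℕ} (i : N) (π : ∀ i, G.Behav i) :
    Measurable fun τ : G.CDIT C => G.utilityEst τ i π :=
  G.measurable_valueEst π G.D [] (by simp)

end POSG

namespace POSG

variable {N : Type uN} [Fintype N] [DecidableEq N] {S : Type uS} [MeasurableSpace S]
  {A : N → Type uA} {O : N → Type uO}
  [∀ i, Fintype (A i)] [∀ i, Fintype (O i)] (G : POSG N S A O)

/-! ### Utilities are affine in the behaviour at each history -/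

open Classical in
/-- The profile `π` with the action distribution `p` for player `i` at the history `h`. -/
noncomputable def updateAt (π : ∀ i, G.Behav i) (i : N) (h : G.Hist i) (p : stdSimplex ℝ (A i)) :
    ∀ i, G.Behav i :=
  Function.update π i (Function.update (π i) h p)

variable {G}

theorem updateAt_same (π : ∀ i, G.Behav i) (i : N) (h : G.Hist i) (p : stdSimplex ℝ (A i)) :
    G.updateAt π i h p i h = p := by
  simp [updateAt]

theorem updateAt_of_ne (π : ∀ i, G.Behav i) (i : N) (h : G.Hist i) (p : stdSimplex ℝ (A i))
    {j : N} {h' : G.Hist j} (hne : (⟨j, h'⟩ : Σ j, G.Hist j) ≠ ⟨i, h⟩) :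
    G.updateAt π i h p j h' = π j h' := by
  unfold updateAt
  rcases eq_or_ne j i with rfl | hj
  · rw [Function.update_self]
    have hh : h' ≠ h := by
      rintro rfl
      exact hne rfl
    simp [hh]
  · rw [Function.update_of_ne hj]

theorem updateAt_eq_self (π : ∀ i, G.Behav i) (i : N) (h : G.Hist i) :
    G.updateAt π i h (π i h) = π := by
  simp [updateAt]

theorem sum_mul_pointMass {X : Type*} [Fintype X] (p : stdSimplex ℝ X) (y : X) :
    ∑ x, p.1 x * (pointMass x).1 y = p.1 y := by
  classical
  rw [Finset.sum_eq_single y]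
  · simp [pointMass]
  · intro x _ hx
    simp [pointMass, hx.symm]
  · simp

/-- A function of the profile that depends only on the behaviour at histories of length at least
`m`, and is affine in the behaviour at each history. -/
structure IsMultiaffine (m : ℕ) (Φ : (∀ i, G.Behav i) → ℝ) : Prop where
  congr : ∀ π π' : ∀ i, G.Behav i, (∀ i (h : G.Hist i), m ≤ h.1.length → π i h = π' i h) →
    Φ π = Φ π'
  affine : ∀ (π : ∀ i, G.Behav i) (i : N) (h : G.Hist i) (p : stdSimplex ℝ (A i)),
    Φ (G.updateAt π i h p) = ∑ x, p.1 x * Φ (G.updateAt π i h (pointMass x))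

namespace IsMultiaffine

variable {m : ℕ} {Φ Ψ : (∀ i, G.Behav i) → ℝ}

theorem const (c : ℝ) : IsMultiaffine (G := G) m fun _ => c :=
  ⟨fun _ _ _ => rfl, fun π i h p => by rw [← Finset.sum_mul, p.2.2, one_mul]⟩

theorem add (hΦ : IsMultiaffine m Φ) (hΨ : IsMultiaffine m Ψ) :
    IsMultiaffine m fun π => Φ π + Ψ π :=
  ⟨fun π π' h => by rw [hΦ.congr π π' h, hΨ.congr π π' h], fun π i h p => by
    rw [hΦ.affine, hΨ.affine, ← Finset.sum_add_distrib]
    exact Finset.sum_congr rfl fun x _ => (mul_add _ _ _).symm⟩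

theorem const_mul (hΦ : IsMultiaffine m Φ) (c : ℝ) : IsMultiaffine m fun π => c * Φ π :=
  ⟨fun π π' h => by rw [hΦ.congr π π' h], fun π i h p => by
    rw [hΦ.affine, Finset.mul_sum]
    exact Finset.sum_congr rfl fun x _ => mul_left_comm _ _ _⟩

theorem sum {κ : Type*} (s : Finset κ) {F : κ → (∀ i, G.Behav i) → ℝ}
    (hF : ∀ k, IsMultiaffine m (F k)) : IsMultiaffine m fun π => ∑ k ∈ s, F k π :=
  ⟨fun π π' h => Finset.sum_congr rfl fun k _ => (hF k).congr π π' h, fun π i h p => by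
    simp_rw [Finset.mul_sum]
    rw [Finset.sum_comm]
    exact Finset.sum_congr rfl fun k _ => (hF k).affine π i h p⟩

theorem integral {α : Type*} [MeasurableSpace α] {μ : Measure α}
    {F : (∀ i, G.Behav i) → α → ℝ} (hF : ∀ x, IsMultiaffine m fun π => F π x)
    (hint : ∀ π, Integrable (F π) μ) : IsMultiaffine m fun π => ∫ x, F π x ∂μ :=
  ⟨fun π π' h => integral_congr_ae (Filter.Eventually.of_forall fun x => (hF x).congr π π' h),
    fun π i h p => by
      simp_rw [fun x => (hF x).affine π i h p]
      rw [integral_finsetSum _ fun x _ => (hint _).const_mul _]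
      exact Finset.sum_congr rfl fun x _ => integral_const_mul _ _⟩

/-- Each player's behaviour at the own part of `l` enters the product once, and what follows `l`
depends on longer histories only. A change at one history thus affects either a single factor of
`actProb` or only the functions `F a`, never both. -/
theorem sum_actProb_mul {l : G.JointHist} {n : ℕ} (hl : l.length + n = G.D)
    {F : (∀ i, A i) → (∀ i, G.Behav i) → ℝ} (hF : ∀ a, IsMultiaffine (l.length + 1) (F a)) :
    IsMultiaffine l.length fun π => ∑ a, G.actProb π l hl a * F a π := by
  have hlen : ∀ j, (G.info j l hl).1.length = l.length := fun j => by simp [info, proj]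
  refine ⟨fun π π' h => Finset.sum_congr rfl fun a _ => ?_, fun π i h p => ?_⟩
  · congr 1
    · exact Finset.prod_congr rfl fun j _ => by rw [h j _ (hlen j).ge]
    · exact (hF a).congr π π' fun j h' hh => h j h' (by omega)
  · by_cases hh : h = G.info i l hl
    · have hact : ∀ q a, G.actProb (G.updateAt π i h q) l hl a =
          q.1 (a i) * ∏ j ∈ Finset.univ.erase i, (π j (G.info j l hl)).1 (a j) := by
        intro q a
        unfold actProb
        rw [← Finset.mul_prod_erase _ _ (Finset.mem_univ i), ← hh, updateAt_same]
        congr 1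
        refine Finset.prod_congr rfl fun j hj => ?_
        rw [updateAt_of_ne]
        intro he
        exact Finset.ne_of_mem_erase hj (congrArg Sigma.fst he)
      have hFc : ∀ q a, F a (G.updateAt π i h q) = F a π := fun q a =>
        (hF a).congr _ _ fun j h' hl' => updateAt_of_ne _ _ _ _ fun he => by
          have h1 : ∀ x y : Σ j, G.Hist j, x = y → x.2.1.length = y.2.1.length := by
            rintro x y rfl; rfl
          have := h1 _ _ he
          rw [hh, hlen] at this
          simp only at this
          omega
      simp_rw [hact, hFc, Finset.mul_sum]
      rw [Finset.sum_comm]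
      refine Finset.sum_congr rfl fun a _ => ?_
      rw [← sum_mul_pointMass p (a i), Finset.sum_mul, Finset.sum_mul]
      exact Finset.sum_congr rfl fun x _ => by ring
    · have hact : ∀ q a, G.actProb (G.updateAt π i h q) l hl a = G.actProb π l hl a := by
        intro q a
        refine Finset.prod_congr rfl fun j _ => ?_
        rw [updateAt_of_ne]
        rintro he
        obtain ⟨rfl, he⟩ := Sigma.mk.inj_iff.1 he
        exact hh (eq_of_heq he).symm
      simp_rw [hact, Finset.mul_sum]
      rw [Finset.sum_comm]
      refine Finset.sum_congr rfl fun a _ => ?_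
      rw [(hF a).affine π i h p, Finset.mul_sum]
      exact Finset.sum_congr rfl fun x _ => mul_left_comm _ _ _

/-- A multiaffine function that is bounded at pure profiles is bounded. -/
theorem abs_le_of_pure (hΦ : IsMultiaffine m Φ) {M : ℝ}
    (hM : ∀ σ : ∀ i, G.Pure i, |Φ fun j => (σ j).toBehav| ≤ M) (π : ∀ i, G.Behav i) :
    |Φ π| ≤ M := by
  classical
  have : Fintype (Σ i, G.Hist i) := Fintype.ofFinite _
  -- Induction on the set of pairs of player and history at which the behaviour may fail to be a
  -- point mass; one such pair is averaged out at a time.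
  suffices h : ∀ (s : Finset (Σ i, G.Hist i)) (π : ∀ i, G.Behav i),
      (∀ k ∉ s, ∃ a, π k.1 k.2 = pointMass a) → |Φ π| ≤ M from
    h Finset.univ π fun k hk => absurd (Finset.mem_univ k) hk
  intro s
  induction s using Finset.induction_on with
  | empty =>
    intro π hπ
    choose σ hσ using fun k => hπ k (Finset.notMem_empty k)
    have : π = fun j => Pure.toBehav (G := G) fun h => σ ⟨j, h⟩ :=
      funext fun j => funext fun h => hσ ⟨j, h⟩
    rw [this]
    exact hM fun j h => σ ⟨j, h⟩
  | insert k s _ ih =>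
    intro π hπ
    obtain ⟨i, h⟩ := k
    rw [← updateAt_eq_self π i h, hΦ.affine]
    refine (Finset.abs_sum_le_sum_abs _ _).trans ?_
    calc _ ≤ ∑ x, (π i h).1 x * M := Finset.sum_le_sum fun x _ => by
          rw [abs_mul, abs_of_nonneg ((π i h).2.1 x)]
          refine mul_le_mul_of_nonneg_left (ih _ fun k hk => ?_) ((π i h).2.1 x)
          by_cases hki : k = ⟨i, h⟩
          · subst hki
            exact ⟨x, updateAt_same _ _ _ _⟩
          · rw [updateAt_of_ne _ _ _ _ hki]
            exact hπ k (by simp [hki, hk])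
      _ = M := by rw [← Finset.sum_mul, (π i h).2.2, one_mul]

end IsMultiaffine

variable {i : N} {R : ℝ}

theorem isMultiaffine_value (hR : ∀ s a, |G.r i s a| ≤ R) (n : ℕ) :
    ∀ (l : G.JointHist) (hl : l.length + n = G.D) (s : S),
      IsMultiaffine l.length fun π => G.value π i n l hl s := by
  induction n with
  | zero =>
    intro l hl s
    simp only [value]
    exact IsMultiaffine.sum_actProb_mul hl fun a => IsMultiaffine.const _
  | succ n ih =>
    intro l hl s
    simp only [value]
    refine IsMultiaffine.sum_actProb_mul hl fun a => (IsMultiaffine.const _).add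
      (IsMultiaffine.const_mul (IsMultiaffine.integral (fun s' => IsMultiaffine.sum _ fun o =>
        IsMultiaffine.const_mul (ih ((a, o) :: l) _ s') _) fun π => ?_) _)
    exact integrable_finsetSum _ fun o _ => G.integrable_Z_mul a s o
      (G.measurable_value π i n _ _) (G.abs_value_le hR π n _ _)

theorem isMultiaffine_utility (hR : ∀ s a, |G.r i s a| ≤ R) :
    IsMultiaffine 0 fun π => G.utility i π :=
  IsMultiaffine.integral (fun s => isMultiaffine_value hR G.D [] (by simp) s) fun π =>
    Integrable.of_bound (G.measurable_value π i G.D [] (by simp)).aestronglyMeasurable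
      (R * G.partialGeom G.D)
      (Filter.Eventually.of_forall (G.abs_value_le hR π G.D [] (by simp)))

theorem isMultiaffine_valueEst {C : ℕ} (n : ℕ) :
    ∀ (l : G.JointHist) (hl : l.length + n = G.D) (b : G.Belief C) (τ : G.Tree C n),
      IsMultiaffine l.length fun π => G.valueEst π i n l hl b τ := by
  induction n with
  | zero =>
    intro l hl b τ
    simp only [valueEst]
    exact IsMultiaffine.sum_actProb_mul hl fun a => IsMultiaffine.const _
  | succ n ih =>
    intro l hl b τ
    simp only [valueEst]
    exact IsMultiaffine.sum_actProb_mul hl fun a => (IsMultiaffine.const _).add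
      (IsMultiaffine.const_mul (IsMultiaffine.sum _ fun k =>
        ih ((a, (τ (a, k)).1.1) :: l) _ _ _) _)

/-- Errors of estimated utilities are largest at pure profiles. -/
theorem abs_utilityEst_sub_utility_le {C : ℕ} (hR : ∀ s a, |G.r i s a| ≤ R) {τ : G.CDIT C}
    {M : ℝ} (hM : ∀ σ : ∀ i, G.Pure i,
      |G.utilityEst τ i (fun j => (σ j).toBehav) - G.utility i fun j => (σ j).toBehav| ≤ M)
    (π : ∀ i, G.Behav i) : |G.utilityEst τ i π - G.utility i π| ≤ M := by
  have h := (isMultiaffine_valueEst (i := i) G.D [] (by simp) τ.1 τ.2).add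
    ((isMultiaffine_utility hR).const_mul (-1))
  have h1 := h.abs_le_of_pure (M := M) (fun σ => by
    rw [neg_one_mul, ← sub_eq_add_neg]; exact hM σ) π
  rwa [neg_one_mul, ← sub_eq_add_neg] at h1

end POSG

namespace POSG

variable {N : Type uN} [Fintype N] [DecidableEq N] {S : Type uS} [MeasurableSpace S]
  {A : N → Type uA} {O : N → Type uO}
  [∀ i, Fintype (A i)] [∀ i, Fintype (O i)] (G : POSG N S A O)

/-! ### Surrogate policies and deviation incentives -/

variable {G}

theorem self_mem_sampledHist {C : ℕ} (n : ℕ) (l : G.JointHist) (τ : G.Tree C n) :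
    l ∈ G.sampledHist n l τ := by
  cases n with
  | zero => exact Set.mem_singleton l
  | succ n => exact Set.mem_union_left _ (Set.mem_singleton l)

/-- The recursion consults policies only at the histories of nodes of the tree. This is why the
default behaviour of surrogates elsewhere is harmless. -/
theorem valueEst_congr {C : ℕ} {π π' : ∀ i, G.Behav i} (i : N) (n : ℕ) :
    ∀ (l : G.JointHist) (hl : l.length + n = G.D) (b : G.Belief C) (τ : G.Tree C n),
      (∀ j (h : G.Hist j), (∃ l' ∈ G.sampledHist n l τ, G.proj j l' = h.1) → π j h = π' j h) →
      G.valueEst π i n l hl b τ = G.valueEst π' i n l hl b τ := by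
  have hact : ∀ {n : ℕ} (l : G.JointHist) (hl : l.length + n = G.D) (τ : G.Tree C n),
      (∀ j (h : G.Hist j), (∃ l' ∈ G.sampledHist n l τ, G.proj j l' = h.1) → π j h = π' j h) →
      ∀ a, G.actProb π l hl a = G.actProb π' l hl a := fun l hl τ h a =>
    Finset.prod_congr rfl fun j _ => by
      rw [h j (G.info j l hl) ⟨l, self_mem_sampledHist _ l τ, rfl⟩]
  induction n with
  | zero =>
    intro l hl b τ h
    simp only [valueEst, hact l hl τ h]
  | succ n ih =>
    intro l hl b τ h
    simp only [valueEst, hact l hl τ h]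
    refine Finset.sum_congr rfl fun a _ => ?_
    congr 3
    refine Finset.sum_congr rfl fun k _ => ih _ _ _ _ fun j h' ⟨l', hl', hp⟩ =>
      h j h' ⟨l', Set.mem_union_right _ (Set.mem_iUnion.2 ⟨(a, k), hl'⟩), hp⟩

theorem utilityEst_congr {C : ℕ} {τ : G.CDIT C} {π π' : ∀ i, G.Behav i} (i : N)
    (h : ∀ j, ∀ x ∈ G.sampledInfo τ j, π j x = π' j x) :
    G.utilityEst τ i π = G.utilityEst τ i π' :=
  valueEst_congr i G.D [] _ τ.1 τ.2 fun j x hx => h j x hx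

/-- If two utility functions are close and the deviations in `K` are as good as all deviations in
the second one, the deviation incentives are close. -/
theorem devIncentive_univ_le {P : N → Type*} {i : N} [Nonempty (P i)] {u v : (∀ i, P i) → ℝ}
    {ε : ℝ} (huv : ∀ π, |v π - u π| ≤ ε) {K : Set (P i)}
    (π : ∀ i, P i) (hK : ∀ p, v (Function.update π i p) ≤
      sSup ((fun p => v (Function.update π i p)) '' K)) :
    devIncentive u i Set.univ π ≤ devIncentive v i K π + 2 * ε := by
  unfold devIncentive
  -- One `ε` pays for the utility of the deviation; the other, in `h2`, for that of `π`.
  have h1 : sSup ((fun p => u (Function.update π i p)) '' Set.univ) ≤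
      sSup ((fun p => v (Function.update π i p)) '' K) + ε := by
    refine csSup_le (Set.univ_nonempty.image _) ?_
    rintro _ ⟨p, _, rfl⟩
    have := (abs_le.1 (huv (Function.update π i p))).1
    have := hK p
    simp only
    linarith
  have h2 := (abs_le.1 (huv π)).2
  linarith

theorem bddAbove_image_of_abs_le {P : N → Type*} {i : N} {v : (∀ i, P i) → ℝ} {M : ℝ}
    (hv : ∀ π, |v π| ≤ M) (π : ∀ i, P i) (K : Set (P i)) :
    BddAbove ((fun p => v (Function.update π i p)) '' K) :=
  ⟨M, by rintro _ ⟨p, _, rfl⟩; exact (le_abs_self _).trans (hv _)⟩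

/-- Overwriting a deviation by the default policy outside the tree leaves its estimate unchanged and
yields a surrogate. -/
theorem le_sSup_surrogateBehav {C : ℕ} {τ : G.CDIT C} {i : N} {M : ℝ}
    (hM : ∀ π, |G.utilityEst τ i π| ≤ M) (σ₀ : G.Pure i) (π : ∀ i, G.Behav i) (p : G.Behav i) :
    G.utilityEst τ i (Function.update π i p) ≤
      sSup ((fun p => G.utilityEst τ i (Function.update π i p)) '' G.surrogateBehav τ σ₀) := by
  classical
  refine le_csSup (bddAbove_image_of_abs_le hM π _)
    ⟨fun h => if h ∈ G.sampledInfo τ i then p h else pointMass (σ₀ h),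
      fun h hh => if_neg hh, utilityEst_congr i fun j x hx => ?_⟩
  rcases eq_or_ne j i with rfl | hj
  · simp only [Function.update_self, hx, if_true]
  · simp only [Function.update_of_ne hj]

theorem sum_prod_mixed (x : ∀ i, G.Mixed i) : ∑ σ : ∀ i, G.Pure i, ∏ j, (x j).1 (σ j) = 1 := by
  rw [← Fintype.prod_sum fun j (s : G.Pure j) => (x j).1 s]
  exact Finset.prod_eq_one fun j _ => (x j).2.2

theorem abs_mixedPayoff_le {M : (∀ i, G.Pure i) → ℝ} {B : ℝ} (hM : ∀ σ, |M σ| ≤ B)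
    (x : ∀ i, G.Mixed i) : |G.mixedPayoff M x| ≤ B := by
  have h0 : ∀ σ : ∀ i, G.Pure i, 0 ≤ ∏ j, (x j).1 (σ j) := fun σ =>
    Finset.prod_nonneg fun j _ => (x j).2.1 _
  calc _ ≤ ∑ σ, |(∏ j, (x j).1 (σ j)) * M σ| := Finset.abs_sum_le_sum_abs _ _
    _ ≤ ∑ σ : ∀ i, G.Pure i, (∏ j, (x j).1 (σ j)) * B := Finset.sum_le_sum fun σ _ => by
        rw [abs_mul, abs_of_nonneg (h0 σ)]
        exact mul_le_mul_of_nonneg_left (hM σ) (h0 σ)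
    _ = B := by rw [← Finset.sum_mul, sum_prod_mixed, one_mul]

theorem mixedPayoff_sub (M M' : (∀ i, G.Pure i) → ℝ) (x : ∀ i, G.Mixed i) :
    G.mixedPayoff M x - G.mixedPayoff M' x = G.mixedPayoff (fun σ => M σ - M' σ) x := by
  unfold mixedPayoff
  rw [← Finset.sum_sub_distrib]
  exact Finset.sum_congr rfl fun σ _ => (mul_sub _ _ _).symm

/-- Splitting off the coordinate of player `i` exhibits the payoff as linear in that player's mixed
strategy. -/
theorem mixedPayoff_update (M : (∀ i, G.Pure i) → ℝ) (x : ∀ i, G.Mixed i) (i : N)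
    (p : G.Mixed i) : G.mixedPayoff M (Function.update x i p) =
      ∑ s, p.1 s * ∑ ρ : ∀ j : {j // j ≠ i}, G.Pure j,
        (∏ j, (x j.1).1 (ρ j)) * M ((Equiv.piSplitAt i fun j => G.Pure j).symm (s, ρ)) := by
  unfold mixedPayoff
  rw [← (Equiv.piSplitAt i fun j => G.Pure j).symm.sum_comp, Fintype.sum_prod_type]
  refine Finset.sum_congr rfl fun s _ => ?_
  rw [Finset.mul_sum]
  refine Finset.sum_congr rfl fun ρ _ => ?_
  rw [Fintype.prod_eq_mul_prod_subtype_ne _ i, mul_assoc, Function.update_self]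
  congr 2
  · simp [Equiv.piSplitAt]
  · refine Finset.prod_congr rfl fun j _ => ?_
    rw [Function.update_of_ne j.2]
    simp [Equiv.piSplitAt, j.2]

theorem sum_pointMass_mul {X : Type*} [Fintype X] (y : X) (f : X → ℝ) :
    ∑ x, (pointMass y).1 x * f x = f y := by
  classical
  rw [Finset.sum_eq_single y]
  · simp [pointMass]
  · intro x _ hx
    simp [pointMass, hx]
  · simp

/-- By linearity in the own strategy a mixed deviation is an average of pure ones, and each pure one
has the same estimates as the surrogate that agrees with it on the tree. -/
theorem le_sSup_surrogateMixed {C : ℕ} {τ : G.CDIT C} {i : N} {M : ℝ}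
    (hM : ∀ π, |G.utilityEst τ i π| ≤ M) (σ₀ : G.Pure i) (x : ∀ i, G.Mixed i) (p : G.Mixed i) :
    G.mixedPayoff (G.payoff (G.utilityEst τ) i) (Function.update x i p) ≤
      sSup ((fun p => G.mixedPayoff (G.payoff (G.utilityEst τ) i) (Function.update x i p)) ''
        G.surrogateMixed τ σ₀) := by
  classical
  set P := G.payoff (G.utilityEst τ) i with hP
  have hbdd : BddAbove ((fun p => G.mixedPayoff P (Function.update x i p)) ''
      G.surrogateMixed τ σ₀) :=
    bddAbove_image_of_abs_le (abs_mixedPayoff_le fun σ => hM _) x _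
  have hpure : ∀ s : G.Pure i, ∑ ρ : ∀ j : {j // j ≠ i}, G.Pure j,
        (∏ j, (x j.1).1 (ρ j)) * P ((Equiv.piSplitAt i fun j => G.Pure j).symm (s, ρ)) ≤
      sSup ((fun p => G.mixedPayoff P (Function.update x i p)) '' G.surrogateMixed τ σ₀) := by
    intro s
    let s' : G.Pure i := fun h => if h ∈ G.sampledInfo τ i then s h else σ₀ h
    refine le_csSup hbdd ⟨pointMass s', fun σ hσ => ?_, ?_⟩
    · have hne : σ ≠ s' := by
        rintro rfl
        exact hσ fun h hh => if_neg hh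
      simp [pointMass, hne]
    · simp only
      rw [mixedPayoff_update, sum_pointMass_mul]
      refine Finset.sum_congr rfl fun ρ _ => congrArg _ (utilityEst_congr i fun j h hh => ?_)
      rcases eq_or_ne j i with rfl | hj
      · simp [Pure.toBehav, Equiv.piSplitAt, s', hh]
      · simp [Equiv.piSplitAt, hj]
  rw [mixedPayoff_update]
  calc _ ≤ ∑ s, p.1 s * _ := Finset.sum_le_sum fun s _ =>
        mul_le_mul_of_nonneg_left (hpure s) (p.2.1 s)
    _ = _ := by rw [← Finset.sum_mul, p.2.2, one_mul]

end POSG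

/-! ### Union bound over players and pure profiles, and the conclusion -/

theorem mainTheorem1 {N : Type*} [Fintype N] [DecidableEq N] {S : Type*} [MeasurableSpace S]
    {A O : N → Type*} [∀ i, Fintype (A i)] [∀ i, Nonempty (A i)] [∀ i, Fintype (O i)]
    (G : POSG N S A O) (C : ℕ) [NeZero C] (lam : ℝ) (Rmax : N → ℝ)
    (hR : ∀ i s a, |G.r i s a| ≤ Rmax i)
    (hk : ∀ i, 0 < G.kMax lam C (Rmax i))
    (σ₀ : ∀ i, G.Pure i) :
    ∃ E : Set (G.CDIT C), MeasurableSet E ∧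
      1 - 5 * ∑ i, (G.numPure : ℝ) * (4 * (C : ℝ)) ^ (G.D + 1) *
          Real.exp (-(C : ℝ) * G.kAcute lam C (Rmax i) ^ 2) ≤ (G.cditLaw C).real E ∧
      ∀ τ ∈ E,
        (∀ x : ∀ i, G.Mixed i,
          POSG.nashConv (fun i => G.mixedPayoff (G.payoff G.utility i)) x ≤
            ∑ i, (POSG.devIncentive (G.mixedPayoff (G.payoff (G.utilityEst τ) i)) i
              (G.surrogateMixed τ (σ₀ i)) x + 2 * G.eps lam)) ∧
        (∀ π : ∀ i, G.Behav i,
          POSG.nashConv G.utility π ≤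
            ∑ i, (POSG.devIncentive (G.utilityEst τ i) i (G.surrogateBehav τ (σ₀ i)) π +
              2 * G.eps lam)) := by

  classical
  have hRi : ∀ i, 0 ≤ Rmax i := fun i => by
    have : Nonempty S := nonempty_of_isProbabilityMeasure G.b₀
    exact (abs_nonneg _).trans (hR i (Classical.arbitrary S) fun j => Classical.arbitrary (A j))
  -- Only the finitely many pure profiles enter the exceptional event, so it does not depend on the
  -- profile to which the bound is applied, and that profile may depend on the tree.
  let F : N → (∀ i, G.Pure i) → Set (G.CDIT C) := fun i σ =>
    {τ | G.eps lam < |G.utilityEst τ i (fun j => (σ j).toBehav) -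
      G.utility i fun j => (σ j).toBehav|}
  have hFm : ∀ i σ, MeasurableSet (F i σ) := fun i σ =>
    measurableSet_lt measurable_const ((G.measurable_utilityEst i _).sub_const _).abs
  have hUm : MeasurableSet (⋃ i, ⋃ σ, F i σ) :=
    MeasurableSet.iUnion fun i => MeasurableSet.iUnion fun σ => hFm i σ
  refine ⟨(⋃ i, ⋃ σ, F i σ)ᶜ, hUm.compl, ?_, fun τ hτ => ?_⟩
  · rw [probReal_compl_eq_one_sub hUm]
    refine sub_le_sub_left ?_ _
    have hF : ∀ i σ, (G.cditLaw C).real (F i σ) ≤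
        5 * (4 * C) ^ (G.D + 1) * Real.exp (-C * G.kAcute lam C (Rmax i) ^ 2) := fun i σ =>
      ENNReal.toReal_le_of_le_ofReal (by positivity) (G.cditLaw_fail_le (hR i) (hRi i) (hk i) σ)
    refine (measureReal_iUnion_fintype_le _).trans ?_
    rw [Finset.mul_sum]
    refine Finset.sum_le_sum fun i _ => ?_
    refine (measureReal_iUnion_fintype_le _).trans ?_
    refine (Finset.sum_le_sum fun σ _ => hF i σ).trans_eq ?_
    rw [Finset.sum_const, Finset.card_univ, nsmul_eq_mul, POSG.numPure]
    ring
  · have hτ' : ∀ i (σ : ∀ i, G.Pure i), |G.utilityEst τ i (fun j => POSG.Pure.toBehav (σ j)) -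
        G.utility i fun j => POSG.Pure.toBehav (σ j)| ≤ G.eps lam := by
      intro i σ
      by_contra h
      exact hτ (Set.mem_iUnion.2 ⟨i, Set.mem_iUnion.2 ⟨σ, not_le.1 h⟩⟩)
    have hest : ∀ i π, |G.utilityEst τ i π| ≤ Rmax i * G.partialGeom G.D := fun i π =>
      G.abs_utilityEst_le (hR i) (NeZero.pos C) τ π
    refine ⟨fun x => Finset.sum_le_sum fun i _ => ?_, fun π => Finset.sum_le_sum fun i _ => ?_⟩
    · have : Nonempty (G.Mixed i) := ⟨x i⟩
      exact POSG.devIncentive_univ_le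
        (fun x => by rw [POSG.mixedPayoff_sub]; exact POSG.abs_mixedPayoff_le (hτ' i) x)
        x (POSG.le_sSup_surrogateMixed (hest i) (σ₀ i) x)
    · have : Nonempty (G.Behav i) := ⟨π i⟩
      exact POSG.devIncentive_univ_le (POSG.abs_utilityEst_sub_utility_le (hR i) (hτ' i))
        π (POSG.le_sSup_surrogateBehav (hest i) (σ₀ i) π)
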